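/- A feedforward network with $d$ layers computes $G:\mathbb R^s\to\mathbb R^n$, $G=G_d\circ\dots\circ G_1$, $G_i(\boldsymbol u)=\phi_i(\boldsymbol W^{(i)}\boldsymbol u+\boldsymbol b^{(i)})$, where $\boldsymbol W^{(i)}\in\mathbb R^{N_i\times N_{i-1}}$, $\boldsymbol b^{(i)}\in\mathbb R^{N_i}$, $N_0=s$, $N_d=n$, and $\phi_i:\mathbb R\to\mathbb R$ is applied entrywise. Put $N=\max_{0\le i\le d}N_i$. Let $\operatorname{sign}(p)=1$ for $p>0$ and $\operatorname{sign}(p)=-1$ for $p\le 0$ (applied entrywise), and let $\|\cdot\|$ be the Euclidean norm. There exist universal constants $C,c>0$ such that the following holds. Let $G$ be such a network whose activations $\phi_i$ are all $L$-Lipschitz and whose weights (the entries of all $\boldsymbol W^{(i)}$) are at most $w_{\max}$ in absolute value, with $L,w_{\max}>0$. Let $r\in\mathbb R$, $\epsilon>0$, $\alpha\in(0.5,1]$, and let $\boldsymbol x^*\in\mathbb R^n$ with $\|\boldsymbol x^*\|=1$. Let $\boldsymbol A\in\mathbb R^{m\times n}$ be a random matrix with independent entries $\boldsymbol A_{i,j}\sim\mathcal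 N(0,1)$, and let $\boldsymbol\eta\in\{\pm1\}^m$ be a random vector, independent of $\boldsymbol A$, with independent entries satisfying $\mathbb P\{\boldsymbol\eta_i=1\}=\alpha$. Let the measurements be $$\boldsymbol y=\boldsymbol\eta\odot\operatorname{sign}(\boldsymbol A\boldsymbol x^*)$$ ($\odot$ is the entrywise product), and let $$l(\boldsymbol x)=\|\boldsymbol x\|^2-\frac{\sqrt{2\pi}}{m}\,\boldsymbol y^{\mathsf T}\boldsymbol A\boldsymbol x,\qquad F=\{\boldsymbol z\in\mathbb R^s:\ \|\boldsymbol z\|\le r,\ \|G(\boldsymbol z)\|\le 1\}.$$ If $$m\ \ge\ C\,\epsilon^{-2}\,s\left(r^2+d\log(LNw_{\max})\right),$$ then with probability at least $1-4\exp(-c\,\epsilon^2m)$ the following holds: for every $\delta$ and every $\tilde{\boldsymbol z}\in F$ that minimizes $l(G(\cdot))$ over $F$ to within additive $\delta$ of the optimum, that is, $l(G(\tilde{\boldsymbol z}))\le l(G(\boldsymbol z))+\delta$ for all $\boldsymbol z\in F$, the minimum of $\|G(\boldsymbol z)-\boldsymbol x^*\|^2$ over $F$ is attained and $$\|G(\tilde{\boldsymbol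 z})-\boldsymbol x^*\|^2\ \le\ \min_{\boldsymbol z\in F}\|G(\boldsymbol z)-\boldsymbol x^*\|^2+\frac{\delta+\epsilon}{2\alpha-1}+\frac{2(1-\alpha)}{2\alpha-1}.$$ -/

import Mathlib

open MeasureTheory ProbabilityTheory Matrix

noncomputable section

/-- Feedforward neural networks with input space `ℝ^s`, built layer by layer. The index is the
dimension of the output. A layer consists of a weight matrix `W`, a bias vector `b` and an activation
function `φ : ℝ → ℝ`, which is applied entrywise. -/
inductive FeedforwardNetwork (s : ℕ) : ℕ → Type
  /-- The network without layers: the output is the input `z ∈ ℝ^s`. -/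
  | input : FeedforwardNetwork s s
  /-- Append one layer with `n` output nodes to a network with `k` output nodes. -/
  | layer {k n : ℕ} (F : FeedforwardNetwork s k) (W : Matrix (Fin n) (Fin k) ℝ)
      (b : Fin n → ℝ) (φ : ℝ → ℝ) : FeedforwardNetwork s n

namespace FeedforwardNetwork

/-- The function `G : ℝ^s → ℝ^n` computed by the network; each layer maps `z` to `φ (W z + b)`. -/
def eval {s : ℕ} : {n : ℕ} → FeedforwardNetwork s n →
    EuclideanSpace ℝ (Fin s) → EuclideanSpace ℝ (Fin n)
  | _, input, z => z
  | _, layer F W b φ, z => WithLp.toLp 2 fun i => φ ((W *ᵥ (F.eval z).ofLp) i + b i)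

/-- The number `d` of layers. -/
def depth {s : ℕ} : {n : ℕ} → FeedforwardNetwork s n → ℕ
  | _, input => 0
  | _, layer F _ _ _ => F.depth + 1

/-- The maximal number of nodes `N = max_{0 ≤ i ≤ d} N_i`, where `N_0 = s` is the input dimension
and `N_i` is the number of nodes at the output of the `i`-th layer. -/
def maxWidth {s : ℕ} : {n : ℕ} → FeedforwardNetwork s n → ℕ
  | _, input => s
  | n, layer F _ _ _ => max F.maxWidth n

/-- All entries of all weight matrices are at most `w` in absolute value. -/
def WeightsBoundedBy {s : ℕ} (w : ℝ) : {n : ℕ} → FeedforwardNetwork s n → Prop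
  | _, input => True
  | _, layer F W _ _ => F.WeightsBoundedBy w ∧ ∀ i j, |W i j| ≤ w

/-- The activation function of every layer is `L`-Lipschitz. -/
def ActivationsLipschitz {s : ℕ} (L : NNReal) : {n : ℕ} → FeedforwardNetwork s n → Prop
  | _, input => True
  | _, layer F _ _ φ => F.ActivationsLipschitz L ∧ LipschitzWith L φ

end FeedforwardNetwork

/-- The sign with values in `{±1}`, where `signPM 0 = -1`. -/
def signPM (p : ℝ) : ℝ := if 0 < p then 1 else -1

/-- One-bit measurements with sign flips: `y = η ⊙ sign (A x)`. -/
def oneBitMeasurement {m n : ℕ} (A : Matrix (Fin m) (Fin n) ℝ) (η : Fin m → ℝ)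
    (x : EuclideanSpace ℝ (Fin n)) : Fin m → ℝ :=
  fun i => η i * signPM ((A *ᵥ x.ofLp) i)

/-- The cost function `‖x‖² - (√(2π) / m) yᵀ A x`. -/
def oneBitLoss {m n : ℕ} (A : Matrix (Fin m) (Fin n) ℝ) (y : Fin m → ℝ)
    (x : EuclideanSpace ℝ (Fin n)) : ℝ :=
  ‖x‖ ^ 2 - √(2 * Real.pi) / m * (y ⬝ᵥ (A *ᵥ x.ofLp))

/-- The latent vectors over which one optimizes: `‖z‖ ≤ r` and `‖G z‖ ≤ 1`. -/
def feasibleSet {s n : ℕ} (G : EuclideanSpace ℝ (Fin s) → EuclideanSpace ℝ (Fin n)) (r : ℝ) :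
    Set (EuclideanSpace ℝ (Fin s)) :=
  {z | ‖z‖ ≤ r ∧ ‖G z‖ ≤ 1}

/-- `z` minimizes `f` over `S` to within additive `δ` of the optimum. -/
def IsApproxMinOn {E : Type*} (f : E → ℝ) (S : Set E) (δ : ℝ) (z : E) : Prop :=
  z ∈ S ∧ ∀ z' ∈ S, f z ≤ f z' + δ

end

open scoped ENNReal NNReal InnerProductSpace

/-- The standard Gaussian measure on `ι → ℝ`. -/
noncomputable abbrev gaussianPi (ι : Type*) [Fintype ι] : Measure (ι → ℝ) :=
  Measure.pi fun _ => gaussianReal 0 1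

/-- The expectation of `exp (max_{z ∈ Z} ⟨g, u z⟩)` for a standard Gaussian vector `g`. -/
noncomputable def gaussianExpSup {ι κ : Type*} [Fintype ι] (Z : Finset κ) (u : κ → ι → ℝ) : ℝ≥0∞ :=
  ∫⁻ g, Z.sup (fun z => ENNReal.ofReal (Real.exp (∑ i, g i * u z i))) ∂gaussianPi ι

lemma measurable_finset_sup_ofReal_exp {ι κ : Type*} [Fintype ι] (Z : Finset κ) (u : κ → ι → ℝ) :
    Measurable fun g : ι → ℝ => Z.sup (fun z => ENNReal.ofReal (Real.exp (∑ i, g i * u z i))) := by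
  classical
  induction Z using Finset.induction_on with
  | empty => simp
  | insert z Z _ ih =>
    simp only [Finset.sup_insert]
    exact Measurable.sup (by fun_prop) ih

lemma exp_add_exp_le {p q A B : ℝ} (h : p + q ≤ A + B) (hp : p ≤ max A B) (hq : q ≤ max A B) :
    Real.exp p + Real.exp q ≤ Real.exp A + Real.exp B := by
  wlog hAB : B ≤ A generalizing A B
  · rw [add_comm (Real.exp A)]
    exact this (by linarith) (by rwa [max_comm]) (by rwa [max_comm]) (le_of_not_ge hAB)
  rw [max_eq_left hAB] at hp hq
  wlog hpq : q ≤ p generalizing p q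
  · rw [add_comm (Real.exp p)]
    exact this (by linarith) hq hp (le_of_not_ge hpq)
  by_cases hqB : q ≤ B
  · exact add_le_add (Real.exp_le_exp.2 hp) (Real.exp_le_exp.2 hqB)
  push Not at hqB
  have h1 : Real.exp A = Real.exp p * Real.exp (A - p) := by rw [← Real.exp_add]; ring_nf
  have h2 : Real.exp B = Real.exp q * Real.exp (B - q) := by rw [← Real.exp_add]; ring_nf
  have h3 := Real.add_one_le_exp (A - p)
  have h4 := Real.add_one_le_exp (B - q)
  have h5 : Real.exp q ≤ Real.exp p := Real.exp_le_exp.2 hpq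
  rw [h1, h2]
  nlinarith [mul_le_mul_of_nonneg_left h3 (Real.exp_pos p).le,
    mul_le_mul_of_nonneg_left h4 (Real.exp_pos q).le, Real.exp_pos q,
    mul_le_mul_of_nonneg_right h5 (sub_nonneg.2 hp)]

lemma sup_exp_add_sup_exp_le {κ : Type*} (Z : Finset κ) (a φ ψ : κ → ℝ) (g : ℝ)
    (h1 : ∀ z, |φ z| ≤ |ψ z|) (h2 : ∀ z z', |φ z - φ z'| ≤ |ψ z - ψ z'|) :
    Z.sup (fun z => ENNReal.ofReal (Real.exp (a z + g * φ z))) +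
        Z.sup (fun z => ENNReal.ofReal (Real.exp (a z - g * φ z))) ≤
      Z.sup (fun z => ENNReal.ofReal (Real.exp (a z + g * ψ z))) +
        Z.sup (fun z => ENNReal.ofReal (Real.exp (a z - g * ψ z))) := by
  rcases Z.eq_empty_or_nonempty with rfl | hZ
  · simp
  obtain ⟨z1, hz1, e1⟩ := Finset.exists_mem_eq_sup Z hZ
    (fun z => ENNReal.ofReal (Real.exp (a z + g * φ z)))
  obtain ⟨z2, hz2, e2⟩ := Finset.exists_mem_eq_sup Z hZ
    (fun z => ENNReal.ofReal (Real.exp (a z - g * φ z)))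
  obtain ⟨zA, hzA, hA⟩ := Finset.exists_max_image Z (fun z => a z + g * ψ z) hZ
  obtain ⟨zB, hzB, hB⟩ := Finset.exists_max_image Z (fun z => a z - g * ψ z) hZ
  rw [e1, e2]
  refine le_trans ?_ (add_le_add
    (Finset.le_sup (f := fun z => ENNReal.ofReal (Real.exp (a z + g * ψ z))) hzA)
    (Finset.le_sup (f := fun z => ENNReal.ofReal (Real.exp (a z - g * ψ z))) hzB))
  rw [← ENNReal.ofReal_add (Real.exp_pos _).le (Real.exp_pos _).le,
    ← ENNReal.ofReal_add (Real.exp_pos _).le (Real.exp_pos _).le]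
  apply ENNReal.ofReal_le_ofReal
  have k1 := hA z1 hz1
  have k2 := hB z1 hz1
  have k3 := hA z2 hz2
  have k4 := hB z2 hz2
  have b1 : |g * φ z1| ≤ |g * ψ z1| := by
    rw [abs_mul, abs_mul]; exact mul_le_mul_of_nonneg_left (h1 _) (abs_nonneg _)
  have b2 : |g * φ z2| ≤ |g * ψ z2| := by
    rw [abs_mul, abs_mul]; exact mul_le_mul_of_nonneg_left (h1 _) (abs_nonneg _)
  have b3 : |g * φ z1 - g * φ z2| ≤ |g * ψ z1 - g * ψ z2| := by
    rw [← mul_sub, ← mul_sub, abs_mul, abs_mul]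
    exact mul_le_mul_of_nonneg_left (h2 _ _) (abs_nonneg _)
  have c1 := le_abs_self (g * φ z1)
  have c2 := neg_abs_le (g * φ z2)
  have c3 := le_abs_self (g * φ z1 - g * φ z2)
  have d1 := le_max_left (a zA + g * ψ zA) (a zB - g * ψ zB)
  have d2 := le_max_right (a zA + g * ψ zA) (a zB - g * ψ zB)
  apply exp_add_exp_le
  · rcases abs_cases (g * ψ z1 - g * ψ z2) with h | h <;> linarith
  · rcases abs_cases (g * ψ z1) with h | h <;> linarith
  · rcases abs_cases (g * ψ z2) with h | h <;> linarith

lemma measurePreserving_flip {ι : Type*} [Fintype ι] [DecidableEq ι] (i : ι) :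
    MeasurePreserving (fun (g : ι → ℝ) j => if j = i then -g j else g j)
      (gaussianPi ι) (gaussianPi ι) := by
  refine measurePreserving_pi (fun _ => gaussianReal 0 1) (fun _ => gaussianReal 0 1)
    (f := fun j x => if j = i then -x else x) fun j => ?_
  by_cases h : j = i
  · simp only [h, if_true]
    exact ⟨measurable_neg, by simpa using gaussianReal_map_neg (μ := 0) (v := 1)⟩
  · simp only [h, if_false]
    exact MeasurePreserving.id _

lemma gaussianExpSup_le_of_update {ι κ : Type*} [Fintype ι] [DecidableEq ι] (Z : Finset κ)
    (u v : κ → ι → ℝ) (i : ι) (huv : ∀ z, ∀ j ≠ i, u z j = v z j)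
    (h1 : ∀ z, |u z i| ≤ |v z i|) (h2 : ∀ z z', |u z i - u z' i| ≤ |v z i - v z' i|) :
    gaussianExpSup Z u ≤ gaussianExpSup Z v := by
  have key (w : κ → ι → ℝ) : gaussianExpSup Z w + gaussianExpSup Z w =
      ∫⁻ g, (Z.sup (fun z => ENNReal.ofReal (Real.exp
          (∑ j ∈ Finset.univ.erase i, g j * w z j + g i * w z i))) +
        Z.sup (fun z => ENNReal.ofReal (Real.exp
          (∑ j ∈ Finset.univ.erase i, g j * w z j - g i * w z i)))) ∂gaussianPi ι := by
    have hm := measurable_finset_sup_ofReal_exp Z w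
    rw [lintegral_add_left]
    · congr 1
      · simp only [gaussianExpSup, Finset.sum_erase_add _ _ (Finset.mem_univ i)]
      · rw [gaussianExpSup, ← (measurePreserving_flip i).lintegral_comp hm]
        refine lintegral_congr fun g => ?_
        congr 1
        ext z
        congr 2
        rw [← Finset.sum_erase_add _ _ (Finset.mem_univ i)]
        beta_reduce
        rw [if_pos rfl, neg_mul, sub_eq_add_neg]
        congr 1
        refine Finset.sum_congr rfl fun j hj => ?_
        rw [if_neg (Finset.ne_of_mem_erase hj)]
    · simpa only [Finset.sum_erase_add _ _ (Finset.mem_univ i)] using hm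
  have : gaussianExpSup Z u + gaussianExpSup Z u ≤ gaussianExpSup Z v + gaussianExpSup Z v := by
    rw [key, key]
    refine lintegral_mono fun g => ?_
    have : ∀ z, ∑ j ∈ Finset.univ.erase i, g j * u z j = ∑ j ∈ Finset.univ.erase i, g j * v z j :=
      fun z => Finset.sum_congr rfl fun j hj => by rw [huv z j (Finset.ne_of_mem_erase hj)]
    simp only [this]
    exact sup_exp_add_sup_exp_le Z (fun z => ∑ j ∈ Finset.univ.erase i, g j * v z j)
      (fun z => u z i) (fun z => v z i) (g i) h1 h2
  rw [← two_mul, ← two_mul] at this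
  exact (ENNReal.mul_le_mul_iff_right (by simp) (by simp)).1 this

/-- A Gaussian version of Talagrand's contraction principle. -/
theorem gaussianExpSup_contraction {ι κ : Type*} [Fintype ι] (Z : Finset κ)
    (u v : κ → ι → ℝ) (h1 : ∀ z i, |u z i| ≤ |v z i|)
    (h2 : ∀ z z' i, |u z i - u z' i| ≤ |v z i - v z' i|) :
    gaussianExpSup Z u ≤ gaussianExpSup Z v := by
  classical
  have key (S : Finset ι) :
      gaussianExpSup Z u ≤ gaussianExpSup Z fun z i => if i ∈ S then v z i else u z i := by
    induction S using Finset.induction_on with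
    | empty => simp
    | insert i S hi ih =>
      refine ih.trans (gaussianExpSup_le_of_update Z _ _ i ?_ ?_ ?_)
      · intro z j hj
        simp [hj]
      · intro z
        simpa [hi] using h1 z i
      · intro z z'
        simpa [hi] using h2 z z' i
  simpa using key Finset.univ

lemma measurePreserving_gaussianPi_comp {ι κ : Type*} [Fintype ι] [Fintype κ] {e : ι → κ}
    (he : e.Injective) :
    MeasurePreserving (fun (g : κ → ℝ) i => g (e i)) (gaussianPi κ) (gaussianPi ι) := by
  refine ⟨by fun_prop, ?_⟩
  have h : iIndepFun (fun (k : κ) (g : κ → ℝ) => g k) (gaussianPi κ) :=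
    iIndepFun_pi (X := fun _ => id) fun _ => aemeasurable_id
  rw [(iIndepFun_iff_map_fun_eq_pi_map (fun i => (measurable_pi_apply _).aemeasurable)).1
    (h.precomp he)]
  congr 1
  ext1 i
  exact (measurePreserving_eval (fun _ : κ => gaussianReal 0 1) (e i)).map_eq

lemma gaussianExpSup_extend {ι ι' κ : Type*} [Fintype ι] [Fintype ι'] {e : ι → ι'}
    (he : e.Injective) (Z : Finset κ) (u : κ → ι → ℝ) :
    gaussianExpSup Z (fun z => Function.extend e (u z) 0) = gaussianExpSup Z u := by
  rw [gaussianExpSup, gaussianExpSup, ← (measurePreserving_gaussianPi_comp he).lintegral_comp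
    (measurable_finset_sup_ofReal_exp Z u)]
  refine lintegral_congr fun g => ?_
  congr 1
  ext z
  congr 2
  symm
  refine Fintype.sum_of_injective e he _ _ (fun i hi => ?_) fun i => ?_
  · rw [Function.extend_apply' _ _ _ hi]
    simp
  · rw [he.extend_apply]

lemma gaussianExpSup_comp_equiv {ι κ : Type*} [Fintype ι] (e : ι ≃ ι) (Z : Finset κ)
    (u : κ → ι → ℝ) : gaussianExpSup Z (fun z i => u z (e i)) = gaussianExpSup Z u := by
  rw [← gaussianExpSup_extend e.injective Z fun z i => u z (e i)]
  congr 1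
  ext z i
  obtain ⟨j, rfl⟩ := e.surjective i
  rw [e.injective.extend_apply]

lemma exp_sum_le_average {ι : Type*} [Fintype ι] [Nonempty ι] (x : ι → ℝ) :
    Real.exp (∑ i, x i) ≤ ∑ i, (Fintype.card ι : ℝ)⁻¹ * Real.exp (Fintype.card ι * x i) := by
  have hK : (Fintype.card ι : ℝ) ≠ 0 := by simp
  have := convexOn_exp.map_sum_le (t := Finset.univ) (w := fun _ : ι => (Fintype.card ι : ℝ)⁻¹)
    (p := fun i => Fintype.card ι * x i) (fun _ _ => by positivity) (by simp [hK])
    (fun _ _ => Set.mem_univ _)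
  simpa [smul_eq_mul, ← mul_assoc, inv_mul_cancel₀ hK] using this

lemma ofReal_exp_sum_le_average {ι : Type*} [Fintype ι] [Nonempty ι] (x : ι → ℝ) :
    ENNReal.ofReal (Real.exp (∑ i, x i)) ≤
      ∑ i, (Fintype.card ι : ℝ≥0∞)⁻¹ * ENNReal.ofReal (Real.exp (Fintype.card ι * x i)) := by
  refine (ENNReal.ofReal_le_ofReal (exp_sum_le_average x)).trans ?_
  rw [ENNReal.ofReal_sum_of_nonneg fun _ _ => by positivity]
  refine Finset.sum_le_sum fun i _ => ?_
  rw [ENNReal.ofReal_mul (by positivity), ENNReal.ofReal_inv_of_pos (by simp [Fintype.card_pos]),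
    ENNReal.ofReal_natCast]

lemma sum_inv_card_mul {ι : Type*} [Fintype ι] [Nonempty ι] (a : ℝ≥0∞) :
    ∑ _i : ι, (Fintype.card ι : ℝ≥0∞)⁻¹ * a = a := by
  rw [Finset.sum_const, Finset.card_univ, nsmul_eq_mul, ← mul_assoc,
    ENNReal.mul_inv_cancel (by simp) (by simp), one_mul]

lemma gaussianExpSup_matrix_fin_le {κ : Type*} {N : ℕ} [NeZero N] (Z : Finset κ)
    (M : Fin N → Fin N → ℝ) {w : ℝ} (hM : ∀ i j, |M i j| ≤ w) (v : κ → Fin N → ℝ) :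
    gaussianExpSup Z (fun z i => ∑ j, M i j * v z j) ≤
      gaussianExpSup Z (fun z i => N * w * v z i) := by
  have hw : 0 ≤ w := (abs_nonneg _).trans (hM 0 0)
  have h1 (g : Fin N → ℝ) :
      Z.sup (fun z => ENNReal.ofReal (Real.exp (∑ i, g i * ∑ j, M i j * v z j))) ≤
        ∑ s : Fin N, (Fintype.card (Fin N) : ℝ≥0∞)⁻¹ * Z.sup (fun z => ENNReal.ofReal
          (Real.exp (∑ i, g i * (N * (M i (i + s) * v z (i + s)))))) := by
    refine Finset.sup_le fun z hz => ?_
    have : ∑ i, g i * ∑ j, M i j * v z j = ∑ s : Fin N, ∑ i, g i * (M i (i + s) * v z (i + s)) := by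
      rw [Finset.sum_comm]
      refine Finset.sum_congr rfl fun i _ => ?_
      rw [← Finset.mul_sum, ← Equiv.sum_comp (Equiv.addLeft i)]
      rfl
    rw [this]
    refine (ofReal_exp_sum_le_average _).trans (Finset.sum_le_sum fun s _ => ?_)
    gcongr
    refine le_trans (le_of_eq ?_) (Finset.le_sup (f := fun z => ENNReal.ofReal
          (Real.exp (∑ i, g i * (N * (M i (i + s) * v z (i + s)))))) hz)
    congr 2
    rw [Fintype.card_fin, Finset.mul_sum]
    exact Finset.sum_congr rfl fun i _ => by ring
  calc gaussianExpSup Z (fun z i => ∑ j, M i j * v z j)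
      ≤ ∑ s : Fin N, (Fintype.card (Fin N) : ℝ≥0∞)⁻¹ *
          gaussianExpSup Z (fun z i => N * (M i (i + s) * v z (i + s))) := by
        refine (lintegral_mono h1).trans (le_of_eq ?_)
        rw [lintegral_finsetSum _ fun s _ =>
          (measurable_finset_sup_ofReal_exp Z _).const_mul _]
        refine Finset.sum_congr rfl fun s _ => ?_
        rw [lintegral_const_mul _ (measurable_finset_sup_ofReal_exp Z _)]
        rfl
    _ ≤ ∑ s : Fin N, (Fintype.card (Fin N) : ℝ≥0∞)⁻¹ *
          gaussianExpSup Z (fun z i => N * w * v z i) := by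
        refine Finset.sum_le_sum fun s _ => ?_
        gcongr
        rw [← gaussianExpSup_comp_equiv (Equiv.addRight s) Z (fun z i => N * w * v z i)]
        refine gaussianExpSup_contraction Z _ _ (fun z i => ?_) fun z z' i => ?_
        · rw [Equiv.coe_addRight, abs_mul, abs_mul, abs_mul, abs_mul, mul_assoc, abs_of_nonneg hw]
          gcongr
          exact hM _ _
        · rw [Equiv.coe_addRight, ← mul_sub, ← mul_sub, ← mul_sub, abs_mul, abs_mul, abs_mul,
            abs_mul, mul_assoc, abs_of_nonneg hw]
          gcongr
          exact hM _ _
    _ = gaussianExpSup Z (fun z i => N * w * v z i) := sum_inv_card_mul _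

lemma gaussianExpSup_matrix_le {ι ι' κ : Type*} [Fintype ι] [Fintype ι'] {N : ℕ}
    (hι : Fintype.card ι ≤ N) (hι' : Fintype.card ι' ≤ N) (Z : Finset κ)
    (M : ι → ι' → ℝ) {w : ℝ} (hw : 0 ≤ w) (hM : ∀ i j, |M i j| ≤ w) (v : κ → ι' → ℝ) :
    gaussianExpSup Z (fun z i => ∑ j, M i j * v z j) ≤
      gaussianExpSup Z (fun z i => N * w * v z i) := by
  rcases Nat.eq_zero_or_pos N with rfl | hN
  · have : IsEmpty ι := Fintype.card_eq_zero_iff.1 (by omega)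
    have : IsEmpty ι' := Fintype.card_eq_zero_iff.1 (by omega)
    simp [gaussianExpSup]
  have : NeZero N := ⟨hN.ne'⟩
  obtain ⟨e⟩ := Function.Embedding.nonempty_of_card_le (α := ι) (β := Fin N) (by simpa using hι)
  obtain ⟨e'⟩ := Function.Embedding.nonempty_of_card_le (α := ι') (β := Fin N) (by simpa using hι')
  rw [← gaussianExpSup_extend e.injective, ← gaussianExpSup_extend e'.injective]
  have h1 : (fun z => Function.extend e (fun i => ∑ j, M i j * v z j) 0) =
      fun z i => ∑ j, (Function.extend e (fun i' => Function.extend e' (M i') 0) 0 i j) *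
        Function.extend e' (v z) 0 j := by
    ext z i
    by_cases hi : ∃ i', e i' = i
    · obtain ⟨i', rfl⟩ := hi
      rw [e.injective.extend_apply, e.injective.extend_apply]
      refine Fintype.sum_of_injective e' e'.injective _ _ (fun j hj => ?_) fun j => ?_
      · rw [Function.extend_apply' _ _ _ hj, Pi.zero_apply, zero_mul]
      · rw [e'.injective.extend_apply, e'.injective.extend_apply]
    · rw [Function.extend_apply' _ _ _ hi, Function.extend_apply' _ _ _ hi]
      simp
  have h2 : (fun z => Function.extend e' (fun i => N * w * v z i) 0) =
      fun z i => N * w * Function.extend e' (v z) 0 i := by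
    ext z j
    by_cases hj : ∃ j', e' j' = j
    · obtain ⟨j', rfl⟩ := hj
      rw [e'.injective.extend_apply, e'.injective.extend_apply]
    · rw [Function.extend_apply' _ _ _ hj, Function.extend_apply' _ _ _ hj]
      simp
  rw [h1, h2]
  refine gaussianExpSup_matrix_fin_le Z _ (fun i j => ?_) _
  by_cases hi : ∃ i', e i' = i
  · obtain ⟨i', rfl⟩ := hi
    rw [e.injective.extend_apply]
    by_cases hj : ∃ j', e' j' = j
    · obtain ⟨j', rfl⟩ := hj
      rw [e'.injective.extend_apply]
      exact hM _ _
    · rw [Function.extend_apply' _ _ _ hj]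
      simpa using hw
  · rw [Function.extend_apply' _ _ _ hi]
    simpa using hw

lemma map_gaussianPi_sum_mul {ι : Type*} [Fintype ι] (c : ι → ℝ) :
    (gaussianPi ι).map (fun g => ∑ i, g i * c i) = gaussianReal 0 (∑ i, c i ^ 2).toNNReal := by
  have h := IsGaussian.map_eq_gaussianReal (μ := stdGaussian (EuclideanSpace ℝ ι))
    (innerSL ℝ (WithLp.toLp 2 c))
  rw [variance_dual_stdGaussian, integral_strongDual_stdGaussian, innerSL_apply_norm,
    EuclideanSpace.norm_sq_eq, ← map_pi_eq_stdGaussian, Measure.map_map (by fun_prop)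
      (by fun_prop)] at h
  convert h using 2
  · ext g
    simp [PiLp.inner_apply]
  · simp

lemma lintegral_exp_sq_div_four :
    ∫⁻ x, ENNReal.ofReal (Real.exp (x ^ 2 / 4)) ∂gaussianReal 0 1 = ENNReal.ofReal √2 := by
  rw [gaussianReal_of_var_ne_zero _ one_ne_zero,
    lintegral_withDensity_eq_lintegral_mul _ (measurable_gaussianPDF _ _) (by fun_prop)]
  have h1 : ∀ x : ℝ, (gaussianPDF 0 1 * fun x => ENNReal.ofReal (Real.exp (x ^ 2 / 4))) x =
      ENNReal.ofReal ((√(2 * Real.pi))⁻¹ * Real.exp (-(1 / 4) * x ^ 2)) := fun x => by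
    rw [Pi.mul_apply, gaussianPDF, gaussianPDFReal, ← ENNReal.ofReal_mul (by positivity), mul_assoc,
      ← Real.exp_add]
    congr 3
    · simp
    · simp only [NNReal.coe_one]; ring
  simp_rw [h1]
  rw [← ofReal_integral_eq_lintegral_ofReal
    ((integrable_exp_neg_mul_sq (by norm_num)).const_mul _) (ae_of_all _ fun x => by positivity),
    integral_const_mul, integral_gaussian]
  congr 1
  rw [← Real.sqrt_inv, ← Real.sqrt_mul (by positivity)]
  congr 1
  field_simp
  norm_num

lemma lintegral_exp_sq_le_two {v : ℝ≥0} {θ : ℝ} (hθ : θ * v ≤ 1 / 4) :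
    ∫⁻ x, ENNReal.ofReal (Real.exp (θ * x ^ 2)) ∂gaussianReal 0 v ≤ 2 := by
  have h : gaussianReal 0 v = (gaussianReal 0 1).map (√v * ·) := by
    rw [gaussianReal_map_const_mul]
    congr 1
    · simp
    · ext; simp
  rw [h, lintegral_map (by fun_prop) (by fun_prop)]
  calc _ ≤ ∫⁻ x, ENNReal.ofReal (Real.exp (x ^ 2 / 4)) ∂gaussianReal 0 1 := by
        refine lintegral_mono fun x => ENNReal.ofReal_le_ofReal (Real.exp_le_exp.2 ?_)
        rw [mul_pow, Real.sq_sqrt v.coe_nonneg]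
        nlinarith [sq_nonneg x]
    _ = ENNReal.ofReal √2 := lintegral_exp_sq_div_four
    _ ≤ 2 := by
        rw [← ENNReal.ofReal_ofNat]
        exact ENNReal.ofReal_le_ofReal (Real.sqrt_le_iff.2 ⟨by norm_num, by norm_num⟩)

lemma gaussianExpSup_matrix_le_of_norm_le {ι ι' κ : Type*} [Fintype ι] [Fintype ι'] {N : ℕ}
    (hι : Fintype.card ι ≤ N) (hι' : Fintype.card ι' ≤ N) (Z : Finset κ)
    (M : ι → ι' → ℝ) {w ρ : ℝ} (hw : 0 < w) (hM : ∀ i j, |M i j| ≤ w)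
    (v : κ → EuclideanSpace ℝ ι') (hv : ∀ z ∈ Z, ‖v z‖ ≤ ρ) :
    gaussianExpSup Z (fun z i => ∑ j, M i j * v z j) ≤
      2 * ENNReal.ofReal (Real.exp ((N * w * ρ) ^ 2)) := by
  rcases isEmpty_or_nonempty ι' with hE | hE
  · simp only [gaussianExpSup, Finset.univ_eq_empty, Finset.sum_empty, mul_zero,
      Finset.sum_const_zero, Real.exp_zero, ENNReal.ofReal_one]
    calc _ ≤ ∫⁻ _ : ι → ℝ, 1 ∂gaussianPi ι := lintegral_mono fun _ => Finset.sup_le fun _ _ => le_rfl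
      _ = 1 * 1 := by simp
      _ ≤ _ := by
        gcongr
        · norm_num
        · rw [← ENNReal.ofReal_one]
          exact ENNReal.ofReal_le_ofReal (Real.one_le_exp (sq_nonneg _))
  have hK : 0 < Fintype.card ι' := Fintype.card_pos
  have hN : (0 : ℝ) < N := by exact_mod_cast hK.trans_le hι'
  set K : ℝ := (Fintype.card ι' : ℝ)
  have hKN : K ≤ N := by simpa [K] using hι'
  set θ : ℝ := (4 * w ^ 2 * N)⁻¹
  have hpt (g : ι → ℝ) :
      Z.sup (fun z => ENNReal.ofReal (Real.exp (∑ i, g i * ∑ j, M i j * v z j))) ≤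
        ENNReal.ofReal (Real.exp ((N * w * ρ) ^ 2)) * ∑ j : ι', (Fintype.card ι' : ℝ≥0∞)⁻¹ *
          ENNReal.ofReal (Real.exp (θ * (∑ i, g i * M i j) ^ 2)) := by
    refine Finset.sup_le fun z hz => ?_
    have e1 : ∑ i, g i * ∑ j, M i j * v z j ≤
        (N * w * ρ) ^ 2 + ∑ j, (∑ i, g i * M i j) ^ 2 / (4 * (w * N) ^ 2) := by
      calc ∑ i, g i * ∑ j, M i j * v z j = ∑ j, (∑ i, g i * M i j) * v z j := by
            simp_rw [Finset.mul_sum, Finset.sum_mul]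
            rw [Finset.sum_comm]
            simp_rw [mul_assoc]
        _ ≤ ∑ j, ((N * w) ^ 2 * v z j ^ 2 + (∑ i, g i * M i j) ^ 2 / (4 * (w * N) ^ 2)) := by
            refine Finset.sum_le_sum fun j _ => ?_
            have := sq_nonneg ((N * w) * v z j - (∑ i, g i * M i j) / (2 * (w * N)))
            have e : (∑ i, g i * M i j) ^ 2 / (4 * (w * N) ^ 2) =
              ((∑ i, g i * M i j) / (2 * (w * N))) ^ 2 := by rw [div_pow]; ring
            have e' : (∑ i, g i * M i j) * v z j =
              2 * ((N * w) * v z j) * ((∑ i, g i * M i j) / (2 * (w * N))) := by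
              field_simp
            rw [e, e']
            nlinarith
        _ ≤ _ := by
            rw [Finset.sum_add_distrib, ← Finset.mul_sum, mul_pow (N * w) ρ]
            gcongr
            have h := EuclideanSpace.norm_sq_eq (v z)
            simp only [Real.norm_eq_abs, sq_abs] at h
            rw [← h]
            exact pow_le_pow_left₀ (norm_nonneg _) (hv z hz) 2
    calc _ ≤ ENNReal.ofReal (Real.exp ((N * w * ρ) ^ 2) *
          Real.exp (∑ j, (∑ i, g i * M i j) ^ 2 / (4 * (w * N) ^ 2))) := by
          rw [← Real.exp_add]
          exact ENNReal.ofReal_le_ofReal (Real.exp_le_exp.2 e1)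
      _ ≤ _ := by
          rw [ENNReal.ofReal_mul (Real.exp_pos _).le]
          gcongr
          refine (ofReal_exp_sum_le_average _).trans (Finset.sum_le_sum fun j _ => ?_)
          refine mul_le_mul' le_rfl (ENNReal.ofReal_le_ofReal (Real.exp_le_exp.2 ?_))
          calc K * ((∑ i, g i * M i j) ^ 2 / (4 * (w * N) ^ 2))
              ≤ N * ((∑ i, g i * M i j) ^ 2 / (4 * (w * N) ^ 2)) := by gcongr
            _ = θ * (∑ i, g i * M i j) ^ 2 := by simp only [θ]; field_simp
  refine (lintegral_mono hpt).trans ?_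
  rw [lintegral_const_mul _ (by fun_prop), mul_comm 2]
  gcongr
  rw [lintegral_finsetSum _ fun s _ => by fun_prop]
  calc _ ≤ ∑ _j : ι', (Fintype.card ι' : ℝ≥0∞)⁻¹ * 2 := by
        refine Finset.sum_le_sum fun j _ => ?_
        rw [lintegral_const_mul _ (by fun_prop)]
        gcongr
        have := lintegral_map (μ := gaussianPi ι)
          (f := fun x : ℝ => ENNReal.ofReal (Real.exp (θ * x ^ 2)))
          (g := fun g => ∑ i, g i * M i j) (by fun_prop) (by fun_prop)
        rw [← this, map_gaussianPi_sum_mul]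
        apply lintegral_exp_sq_le_two
        rw [Real.coe_toNNReal _ (by positivity)]
        have : ∑ i, M i j ^ 2 ≤ N * w ^ 2 := by
          calc ∑ i, M i j ^ 2 ≤ ∑ _i : ι, w ^ 2 :=
                Finset.sum_le_sum fun i _ => sq_le_sq' (neg_le_of_abs_le (hM i j))
                  (le_of_abs_le (hM i j))
            _ = Fintype.card ι * w ^ 2 := by simp
            _ ≤ N * w ^ 2 := by gcongr
        calc θ * ∑ i, M i j ^ 2 ≤ θ * (N * w ^ 2) := by gcongr
          _ = 1 / 4 := by simp only [θ]; field_simp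
    _ = 2 := sum_inv_card_mul 2

namespace FeedforwardNetwork

lemma output_le_maxWidth {s n : ℕ} (net : FeedforwardNetwork s n) : n ≤ net.maxWidth := by
  cases net with
  | input => exact le_rfl
  | layer F W b φ => exact le_max_right _ _

lemma continuous_eval {s n : ℕ} {L : ℝ≥0} (net : FeedforwardNetwork s n)
    (h : net.ActivationsLipschitz L) : Continuous net.eval := by
  induction net with
  | input => exact continuous_id
  | layer F W b φ ih =>
    have hF := ih h.1
    have hφ := h.2.continuous
    refine (PiLp.continuous_toLp 2 _).comp (continuous_pi fun i => hφ.comp ?_)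
    simp only [mulVec, dotProduct]
    fun_prop

/-- Dimension-free exponential moments of the Gaussian process indexed by the outputs of a network
with at least one layer, over a ball of latent vectors. -/
theorem gaussianExpSup_eval_le {s n N : ℕ} {L : ℝ≥0} {w : ℝ} (hw : 0 < w)
    (net : FeedforwardNetwork s n) (hW : net.WeightsBoundedBy w) (hφ : net.ActivationsLipschitz L)
    (hN : net.maxWidth ≤ N) (hd : 0 < net.depth) (Z : Finset (EuclideanSpace ℝ (Fin s)))
    (z₀ : EuclideanSpace ℝ (Fin s)) {ρ : ℝ} (hZ : ∀ z ∈ Z, ‖z - z₀‖ ≤ ρ) {t : ℝ} (ht : 0 ≤ t) :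
    gaussianExpSup Z (fun z i => t * (net.eval z i - net.eval z₀ i)) ≤
      2 * ENNReal.ofReal (Real.exp ((t * (L * N * w) ^ net.depth * ρ) ^ 2)) := by
  induction net generalizing t with
  | input => exact absurd hd (lt_irrefl 0)
  | @layer k n F W b φ ih =>
    have hk : Fintype.card (Fin k) ≤ N := by
      simpa using F.output_le_maxWidth.trans ((le_max_left _ _).trans hN)
    have hn : Fintype.card (Fin n) ≤ N := by simpa using (le_max_right _ _).trans hN
    have hlip : ∀ x y, |φ x - φ y| ≤ L * |x - y| := fun x y => by
      simpa [Real.dist_eq] using hφ.2.dist_le_mul x y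
    have hlin (z z' : EuclideanSpace ℝ (Fin s)) (i : Fin n) :
        |t * (φ ((W *ᵥ (F.eval z).ofLp) i + b i) - φ ((W *ᵥ (F.eval z').ofLp) i + b i))| ≤
        |∑ j, W i j * (t * L * (F.eval z j - F.eval z' j))| := by
      have : ∑ j, W i j * (t * L * (F.eval z j - F.eval z' j)) =
          t * (L * (((W *ᵥ (F.eval z).ofLp) i + b i) - ((W *ᵥ (F.eval z').ofLp) i + b i))) := by
        simp only [mulVec, dotProduct, add_sub_add_right_eq_sub, ← Finset.sum_sub_distrib,
          Finset.mul_sum]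
        exact Finset.sum_congr rfl fun j _ => by ring
      rw [this, abs_mul, abs_mul, abs_mul (L : ℝ), abs_of_nonneg L.coe_nonneg]
      exact mul_le_mul_of_nonneg_left (hlip _ _) (abs_nonneg _)
    have h1 : gaussianExpSup Z
        (fun z i => t * ((layer F W b φ).eval z i - (layer F W b φ).eval z₀ i)) ≤
        gaussianExpSup Z (fun z i => ∑ j, W i j * (t * L * (F.eval z j - F.eval z₀ j))) := by
      refine gaussianExpSup_contraction Z _ _ (fun z i => hlin z z₀ i) fun z z' i => ?_
      convert hlin z z' i using 2
      · simp only [eval]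
        ring
      · rw [← Finset.sum_sub_distrib]
        exact Finset.sum_congr rfl fun j _ => by ring
    refine h1.trans ?_
    rcases Nat.eq_zero_or_pos F.depth with h0 | hpos
    · cases F with
      | layer => exact absurd h0 (Nat.succ_ne_zero _)
      | input =>
        have h2 := gaussianExpSup_matrix_le_of_norm_le hn hk Z W hw hW.2
          (fun z => (t * L) • (z - z₀)) (ρ := t * L * ρ) (fun z hz => by
            rw [norm_smul, Real.norm_eq_abs, abs_of_nonneg (by positivity)]
            exact mul_le_mul_of_nonneg_left (hZ z hz) (by positivity))
        simp only [PiLp.smul_apply, PiLp.sub_apply, smul_eq_mul] at h2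
        refine h2.trans (le_of_eq ?_)
        simp only [depth]
        congr 4
        ring
    · refine (gaussianExpSup_matrix_le hn hk Z W hw.le hW.2 _).trans ?_
      have h3 := ih hW.1 hφ.1 ((le_max_left _ _).trans hN) hpos (t := N * w * (t * L))
        (by positivity)
      simp only [← mul_assoc] at h3 ⊢
      refine h3.trans (le_of_eq ?_)
      simp only [depth]
      congr 4
      ring

end FeedforwardNetwork

lemma gaussianPi_exists_lt_le {ι κ : Type*} [Fintype ι] (Z : Finset κ) (u : κ → ι → ℝ) (a : ℝ)
    {t : ℝ} (ht : 0 ≤ t) :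
    gaussianPi ι {g | ∃ z ∈ Z, a < ∑ i, g i * u z i} ≤
      ENNReal.ofReal (Real.exp (-(t * a))) * gaussianExpSup Z (fun z i => t * u z i) := by
  have h := mul_meas_ge_le_lintegral (μ := gaussianPi ι)
    (measurable_finset_sup_ofReal_exp Z (fun z i => t * u z i)) (ENNReal.ofReal (Real.exp (t * a)))
  have hsub : {g | ∃ z ∈ Z, a < ∑ i, g i * u z i} ⊆ {g : ι → ℝ | ENNReal.ofReal (Real.exp (t * a)) ≤
      Z.sup (fun z => ENNReal.ofReal (Real.exp (∑ i, g i * (t * u z i))))} := by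
    rintro g ⟨z, hz, hlt⟩
    refine le_trans ?_ (Finset.le_sup (f := fun z => ENNReal.ofReal
      (Real.exp (∑ i, g i * (t * u z i)))) hz)
    apply ENNReal.ofReal_le_ofReal
    rw [Real.exp_le_exp]
    calc t * a ≤ t * ∑ i, g i * u z i := by gcongr
      _ = _ := by rw [Finset.mul_sum]; exact Finset.sum_congr rfl fun i _ => by ring
  calc gaussianPi ι {g | ∃ z ∈ Z, a < ∑ i, g i * u z i}
      = ENNReal.ofReal (Real.exp (-(t * a))) * (ENNReal.ofReal (Real.exp (t * a)) *
          gaussianPi ι {g | ∃ z ∈ Z, a < ∑ i, g i * u z i}) := by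
        rw [← mul_assoc, ← ENNReal.ofReal_mul (Real.exp_pos _).le, ← Real.exp_add]
        simp
    _ ≤ _ := by
        gcongr
        exact (mul_le_mul' le_rfl (measure_mono hsub)).trans h

lemma lintegral_exp_sum_mul {ι : Type*} [Fintype ι] (c : ι → ℝ) :
    ∫⁻ g, ENNReal.ofReal (Real.exp (∑ i, g i * c i)) ∂gaussianPi ι =
      ENNReal.ofReal (Real.exp ((∑ i, c i ^ 2) / 2)) := by
  have := lintegral_map (μ := gaussianPi ι) (f := fun x : ℝ => ENNReal.ofReal (Real.exp x))
    (g := fun g => ∑ i, g i * c i) (by fun_prop) (by fun_prop)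
  rw [← this, map_gaussianPi_sum_mul, ← ofReal_integral_eq_lintegral_ofReal
    (by simpa using integrable_exp_mul_gaussianReal 1) (ae_of_all _ fun x => (Real.exp_pos x).le)]
  have h := congrFun (mgf_fun_id_gaussianReal (μ := 0) (v := (∑ i, c i ^ 2).toNNReal)) 1
  simp only [mgf, one_mul, zero_add, one_pow, mul_one] at h
  rw [h, Real.coe_toNNReal _ (by positivity)]

lemma lintegral_exp_norm_sq_div_four (ι : Type*) [Fintype ι] :
    ∫⁻ g, ENNReal.ofReal (Real.exp ((∑ i, g i ^ 2) / 4)) ∂gaussianPi ι =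
      ENNReal.ofReal (√2 ^ Fintype.card ι) := by
  have hind : iIndepFun (fun (i : ι) (g : ι → ℝ) => ENNReal.ofReal (Real.exp (g i ^ 2 / 4)))
      (gaussianPi ι) :=
    iIndepFun_pi (X := fun _ x => ENNReal.ofReal (Real.exp (x ^ 2 / 4))) fun _ => by fun_prop
  have h := lintegral_prod_eq_prod_lintegral_of_indepFun Finset.univ _ hind
    (fun i => by fun_prop)
  have h2 (i : ι) : ∫⁻ g : ι → ℝ, ENNReal.ofReal (Real.exp (g i ^ 2 / 4)) ∂gaussianPi ι =
      ENNReal.ofReal √2 := by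
    rw [← lintegral_exp_sq_div_four, ← (measurePreserving_eval (fun _ : ι => gaussianReal 0 1)
      i).lintegral_comp (by fun_prop)]
  simp_rw [h2] at h
  rw [Finset.prod_const, Finset.card_univ, ← ENNReal.ofReal_pow (Real.sqrt_nonneg _)] at h
  rw [← h]
  refine lintegral_congr fun g => ?_
  rw [Finset.sum_div, Real.exp_sum, ENNReal.ofReal_prod_of_nonneg fun _ _ => (Real.exp_pos _).le]

lemma card_le_of_separated_of_norm_le {E : Type*} [NormedAddCommGroup E] [NormedSpace ℝ E]
    [FiniteDimensional ℝ E] (C : Finset E) {r ρ : ℝ} (hr : 0 ≤ r) (hρ : 0 < ρ)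
    (hC : ∀ c ∈ C, ‖c‖ ≤ r) (hsep : ∀ c ∈ C, ∀ d ∈ C, c ≠ d → ρ ≤ ‖c - d‖) :
    (C.card : ℝ) ≤ (1 + 2 * r / ρ) ^ Module.finrank ℝ E := by
  borelize E
  let μ : Measure E := Measure.addHaar
  have hδ : 0 < ρ / 2 := by positivity
  have hR : 0 < r + ρ / 2 := by positivity
  have hdisj : Set.Pairwise (C : Set E) (Function.onFun Disjoint fun c => Metric.ball c (ρ / 2)) := by
    intro c hc d hd hcd
    apply Metric.ball_disjoint_ball
    rw [dist_eq_norm, add_halves]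
    exact hsep c hc d hd hcd
  have hsub : (⋃ c ∈ C, Metric.ball c (ρ / 2)) ⊆ Metric.ball (0 : E) (r + ρ / 2) := by
    refine Set.iUnion₂_subset fun x hx => Metric.ball_subset_ball' ?_
    rw [dist_zero_right]
    linarith [hC x hx]
  have I : (C.card : ℝ≥0∞) * ENNReal.ofReal ((ρ / 2) ^ Module.finrank ℝ E) * μ (Metric.ball 0 1) ≤
      ENNReal.ofReal ((r + ρ / 2) ^ Module.finrank ℝ E) * μ (Metric.ball 0 1) := by
    calc _ = μ (⋃ c ∈ C, Metric.ball c (ρ / 2)) := by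
          rw [measure_biUnion_finset hdisj fun c _ => measurableSet_ball]
          simp only [μ.addHaar_ball_of_pos _ hδ]
          simp only [Finset.sum_const, nsmul_eq_mul, mul_assoc]
      _ ≤ μ (Metric.ball (0 : E) (r + ρ / 2)) := measure_mono hsub
      _ = _ := by rw [μ.addHaar_ball_of_pos _ hR]
  have J := (ENNReal.mul_le_mul_iff_left (Metric.measure_ball_pos μ _ zero_lt_one).ne'
    measure_ball_lt_top.ne).1 I
  have K := ENNReal.toReal_le_of_le_ofReal (pow_nonneg hR.le _) J
  rw [ENNReal.toReal_mul, ENNReal.toReal_natCast, ENNReal.toReal_ofReal (by positivity)] at K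
  have : 1 + 2 * r / ρ = (r + ρ / 2) / (ρ / 2) := by field_simp; ring
  rw [this, div_pow, le_div_iff₀ (by positivity)]
  exact K

lemma exists_separated_net {E : Type*} [NormedAddCommGroup E] [NormedSpace ℝ E]
    [FiniteDimensional ℝ E] (Z : Finset E) {r ρ : ℝ} (hr : 0 ≤ r) (hρ : 0 < ρ)
    (hZ : ∀ z ∈ Z, ‖z‖ ≤ r) :
    ∃ C ⊆ Z, (∀ z ∈ Z, ∃ c ∈ C, ‖z - c‖ ≤ ρ) ∧
      (C.card : ℝ) ≤ (1 + 2 * r / ρ) ^ Module.finrank ℝ E := by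
  classical
  obtain ⟨C, hC, hmax⟩ := Finset.exists_max_image
    (Z.powerset.filter fun C => ∀ c ∈ C, ∀ d ∈ C, c ≠ d → ρ ≤ ‖c - d‖) Finset.card
    ⟨∅, by simp⟩
  simp only [Finset.mem_filter, Finset.mem_powerset] at hC hmax
  refine ⟨C, hC.1, fun z hz => ?_, card_le_of_separated_of_norm_le C hr hρ
    (fun c hc => hZ c (hC.1 hc)) hC.2⟩
  by_contra! hcon
  have hzC : z ∉ C := fun h => by
    have := hcon z h
    simp only [sub_self, norm_zero] at this
    linarith
  have := hmax (insert z C) ⟨Finset.insert_subset hz hC.1, fun c hc d hd hcd => by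
    rcases Finset.mem_insert.1 hc with rfl | hc' <;> rcases Finset.mem_insert.1 hd with rfl | hd'
    · exact absurd rfl hcd
    · exact (hcon d hd').le
    · rw [norm_sub_rev]
      exact (hcon c hc').le
    · exact hC.2 c hc' d hd' hcd⟩
  rw [Finset.card_insert_of_notMem hzC] at this
  omega

lemma gaussianPi_exists_lt_le_of_expSup_le {ι κ : Type*} [Fintype ι] (Z : Finset κ)
    (u : κ → ι → ℝ) {a b t : ℝ} (ht : 0 ≤ t)
    (h : gaussianExpSup Z (fun z i => t * u z i) ≤ 2 * ENNReal.ofReal (Real.exp b)) :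
    gaussianPi ι {g | ∃ z ∈ Z, a < ∑ i, g i * u z i} ≤
      2 * ENNReal.ofReal (Real.exp (b - t * a)) := by
  refine (gaussianPi_exists_lt_le Z u a ht).trans ((mul_le_mul' le_rfl h).trans (le_of_eq ?_))
  rw [mul_left_comm, ← ENNReal.ofReal_mul (Real.exp_pos _).le, ← Real.exp_add]
  congr 3
  ring

lemma gaussianExpSup_le_of_decomposition {ι κ : Type*} [Fintype ι] (Z : Finset κ)
    (u v : κ → ι → ℝ) (c : ι → ℝ) (huv : ∀ z i, u z i = v z i + c i) :
    gaussianExpSup Z u ≤ 2⁻¹ * (gaussianExpSup Z (fun z i => 2 * v z i) +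
      ENNReal.ofReal (Real.exp (2 * ∑ i, c i ^ 2))) := by
  have h1 : ENNReal.ofReal (Real.exp (2 * ∑ i, c i ^ 2)) =
      ∫⁻ g, ENNReal.ofReal (Real.exp (∑ i, g i * (2 * c i))) ∂gaussianPi ι := by
    rw [lintegral_exp_sum_mul]
    congr 2
    rw [Finset.mul_sum, Finset.sum_div]
    exact Finset.sum_congr rfl fun i _ => by ring
  rw [h1, gaussianExpSup, gaussianExpSup, ← lintegral_add_right _ (by fun_prop),
    ← lintegral_const_mul _ (by
      have := measurable_finset_sup_ofReal_exp Z (fun z i => 2 * v z i)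
      fun_prop)]
  refine lintegral_mono fun g => Finset.sup_le fun z hz => ?_
  refine le_trans ?_ (mul_le_mul' le_rfl (add_le_add (Finset.le_sup (f := fun z => ENNReal.ofReal
      (Real.exp (∑ i, g i * (2 * v z i)))) hz) le_rfl))
  have e : ∑ i, g i * u z i = ∑ k : Fin 2, ![∑ i, g i * v z i, ∑ i, g i * c i] k := by
    simp [huv, mul_add, Finset.sum_add_distrib]
  rw [e]
  refine (ofReal_exp_sum_le_average _).trans (le_of_eq ?_)
  have hs (x : ι → ℝ) : 2 * ∑ i, g i * x i = ∑ i, g i * (2 * x i) := by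
    rw [Finset.mul_sum]
    exact Finset.sum_congr rfl fun i _ => by ring
  simp [Fin.sum_univ_two, hs, mul_add]

namespace FeedforwardNetwork

lemma gaussianPi_exists_lt_input_le {s : ℕ} {r a : ℝ} (ha : 0 < a)
    (h : 192 * (s * r ^ 2) ≤ a ^ 2) (Z : Finset (EuclideanSpace ℝ (Fin s)))
    (zbar : EuclideanSpace ℝ (Fin s)) (hZ : ∀ z ∈ Z, ‖z‖ ≤ min r 1) (hzbar : ‖zbar‖ ≤ min r 1) :
    gaussianPi (Fin s) {g | ∃ z ∈ Z, a < ∑ i, g i * (z i - zbar i)} ≤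
      2 * ENNReal.ofReal (Real.exp (-(a ^ 2 / 64))) := by
  set q := min r 1
  have hq0 : 0 ≤ q := (norm_nonneg _).trans hzbar
  have hq1 : q ≤ 1 := min_le_right _ _
  have hqr : q ≤ r := min_le_left _ _
  have hdist (g : Fin s → ℝ) (z) (hz : z ∈ Z) :
      ∑ i, g i * (z i - zbar i) ≤ √(∑ i, g i ^ 2) * (2 * q) := by
    have h1 := Real.sum_mul_le_sqrt_mul_sqrt Finset.univ g (fun i => z i - zbar i)
    have h2 : √(∑ i, (z i - zbar i) ^ 2) = ‖z - zbar‖ := by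
      simp [EuclideanSpace.norm_eq]
    rw [h2] at h1
    refine h1.trans (mul_le_mul_of_nonneg_left ?_ (Real.sqrt_nonneg _))
    linarith [norm_sub_le z zbar, hZ z hz]
  rcases hq0.eq_or_lt with hq | hq
  · have : {g : Fin s → ℝ | ∃ z ∈ Z, a < ∑ i, g i * (z i - zbar i)} = ∅ := by
      ext g
      simp only [Set.mem_ofPred_eq, Set.mem_empty_iff_false, iff_false]
      rintro ⟨z, hz, hlt⟩
      have := hdist g z hz
      rw [← hq] at this
      linarith
    simp [this]
  set T := a ^ 2 / (16 * q ^ 2)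
  have hsub : {g : Fin s → ℝ | ∃ z ∈ Z, a < ∑ i, g i * (z i - zbar i)} ⊆
      {g | ENNReal.ofReal (Real.exp T) ≤ ENNReal.ofReal (Real.exp ((∑ i, g i ^ 2) / 4))} := by
    rintro g ⟨z, hz, hlt⟩
    apply ENNReal.ofReal_le_ofReal
    rw [Real.exp_le_exp]
    have h1 : a ≤ √(∑ i, g i ^ 2) * (2 * q) := hlt.le.trans (hdist g z hz)
    have h2 := pow_le_pow_left₀ ha.le h1 2
    rw [mul_pow, Real.sq_sqrt (by positivity)] at h2
    rw [div_le_div_iff₀ (by positivity) (by norm_num)]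
    linarith
  have hmk := mul_meas_ge_le_lintegral (μ := gaussianPi (Fin s))
    (f := fun g => ENNReal.ofReal (Real.exp ((∑ i, g i ^ 2) / 4))) (by fun_prop)
    (ENNReal.ofReal (Real.exp T))
  rw [lintegral_exp_norm_sq_div_four, Fintype.card_fin] at hmk
  have hpow : √2 ^ s ≤ Real.exp (s / 2) := by
    have : √2 ≤ Real.exp (1 / 2) := by
      rw [Real.sqrt_le_left (Real.exp_pos _).le, ← Real.exp_nat_mul]
      norm_num
      linarith [Real.add_one_le_exp (1 : ℝ)]
    calc √2 ^ s ≤ Real.exp (1 / 2) ^ s := pow_le_pow_left₀ (Real.sqrt_nonneg _) this _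
      _ = _ := by rw [← Real.exp_nat_mul]; ring_nf
  have hs : (s : ℝ) / 2 - T ≤ -(a ^ 2 / 64) := by
    have h1 : 192 * (s * q ^ 2) ≤ a ^ 2 :=
      le_trans (by gcongr) h
    have h2 : (s : ℝ) / 2 ≤ T / 2 := by
      gcongr
      rw [le_div_iff₀ (by positivity)]
      nlinarith [show (0 : ℝ) ≤ s * q ^ 2 by positivity]
    have h3 : a ^ 2 / 16 ≤ T := by
      apply div_le_div_of_nonneg_left (sq_nonneg _) (by positivity)
      nlinarith
    linarith [sq_nonneg a]
  calc gaussianPi (Fin s) {g | ∃ z ∈ Z, a < ∑ i, g i * (z i - zbar i)}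
      = ENNReal.ofReal (Real.exp (-T)) * (ENNReal.ofReal (Real.exp T) *
          gaussianPi (Fin s) {g | ∃ z ∈ Z, a < ∑ i, g i * (z i - zbar i)}) := by
        rw [← mul_assoc, ← ENNReal.ofReal_mul (Real.exp_pos _).le, ← Real.exp_add]
        simp
    _ ≤ ENNReal.ofReal (Real.exp (-T)) * ENNReal.ofReal (Real.exp (s / 2)) := by
        gcongr
        exact ((mul_le_mul' le_rfl (measure_mono hsub)).trans hmk).trans
          (ENNReal.ofReal_le_ofReal hpow)
    _ ≤ 1 * ENNReal.ofReal (Real.exp (-(a ^ 2 / 64))) := by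
        rw [one_mul, ← ENNReal.ofReal_mul (Real.exp_pos _).le, ← Real.exp_add]
        apply ENNReal.ofReal_le_ofReal
        rw [Real.exp_le_exp]
        linarith
    _ ≤ _ := by
        gcongr
        norm_num

/-- Tail bound for the Gaussian process indexed by the outputs of a network. -/
theorem gaussianPi_exists_lt_eval_le {s n : ℕ} {L : ℝ≥0} {w r a : ℝ} (hL : 0 < L) (hw : 0 < w)
    (ha : 0 < a) (net : FeedforwardNetwork s n) (hW : net.WeightsBoundedBy w)
    (hφ : net.ActivationsLipschitz L)
    (h : 192 * (s * (r ^ 2 + net.depth * Real.log (L * net.maxWidth * w))) ≤ a ^ 2)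
    (Z : Finset (EuclideanSpace ℝ (Fin s))) (zbar : EuclideanSpace ℝ (Fin s))
    (hZ : ∀ z ∈ Z, z ∈ feasibleSet net.eval r) (hzbar : zbar ∈ feasibleSet net.eval r) :
    gaussianPi (Fin n) {g | ∃ z ∈ Z, a < ∑ i, g i * (net.eval z i - net.eval zbar i)} ≤
      2 * ENNReal.ofReal (Real.exp (-(a ^ 2 / 64))) := by
  rcases Nat.eq_zero_or_pos n with rfl | hn
  · simp [not_lt.2 ha.le]
  rcases Nat.eq_zero_or_pos net.depth with h0 | hd
  · cases net with
    | layer => exact absurd h0 (Nat.succ_ne_zero _)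
    | input =>
      refine gaussianPi_exists_lt_input_le (r := r) ha ?_ Z zbar (fun z hz => le_min (hZ z hz).1
        (hZ z hz).2) (le_min hzbar.1 hzbar.2)
      simpa [depth] using h
  have hN : 0 < (net.maxWidth : ℝ) := by exact_mod_cast hn.trans_le net.output_le_maxWidth
  have hr : 0 ≤ r := (norm_nonneg _).trans hzbar.1
  set Λ := (L * net.maxWidth * w) ^ net.depth with hΛ
  have hΛ0 : 0 < Λ := by positivity
  by_cases hrΛ : r * Λ ≤ 1
  · have h1 := net.gaussianExpSup_eval_le hw hW hφ le_rfl hd Z zbar (ρ := 2 * r)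
      (fun z hz => by linarith [norm_sub_le z zbar, (hZ z hz).1, hzbar.1])
      (t := a / 8) (by positivity)
    refine (gaussianPi_exists_lt_le_of_expSup_le Z _ (t := a / 8) (by positivity) h1).trans ?_
    rw [← hΛ]
    gcongr
    have : a / 8 * Λ * (2 * r) ≤ a / 4 := by nlinarith
    have := pow_le_pow_left₀ (by positivity) this 2
    nlinarith [sq_nonneg a]
  push Not at hrΛ
  obtain ⟨C, hCZ, hcov, hcard⟩ := exists_separated_net Z hr (ρ := Λ⁻¹) (by positivity)
    (fun z hz => (hZ z hz).1)
  rw [finrank_euclideanSpace_fin, div_inv_eq_mul] at hcard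
  have hcard' : (C.card : ℝ) ≤ Real.exp (a ^ 2 / 64) := by
    have hr0 : 0 < r := by
      by_contra hcon
      have : r = 0 := by linarith
      rw [this] at hrΛ
      linarith
    have e1 : 1 + 2 * r * Λ ≤ Real.exp (3 * (1 / 2 + Real.log (r * Λ))) := by
      have hlog := Real.log_nonneg hrΛ.le
      calc 1 + 2 * r * Λ ≤ 3 * 1 * (r * Λ) := by nlinarith
        _ ≤ 3 * Real.exp (2 * Real.log (r * Λ)) * (r * Λ) := by
          gcongr
          exact Real.one_le_exp (by linarith)
        _ ≤ Real.exp (3 / 2) * Real.exp (2 * Real.log (r * Λ)) * Real.exp (Real.log (r * Λ)) := by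
          rw [Real.exp_log (by positivity)]
          gcongr
          linarith [Real.quadratic_le_exp_of_nonneg (show (0 : ℝ) ≤ 3 / 2 by norm_num)]
        _ = _ := by rw [← Real.exp_add, ← Real.exp_add]; ring_nf
    have e2 : 1 / 2 + Real.log (r * Λ) ≤
        r ^ 2 + net.depth * Real.log (L * net.maxWidth * w) := by
      rw [Real.log_mul hr0.ne' hΛ0.ne', hΛ, Real.log_pow]
      nlinarith [Real.log_le_sub_one_of_pos hr0, sq_nonneg (r - 1 / 2)]
    calc (C.card : ℝ) ≤ (1 + 2 * r * Λ) ^ s := hcard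
      _ ≤ Real.exp (3 * (1 / 2 + Real.log (r * Λ))) ^ s := by gcongr
      _ = Real.exp (3 * (s * (1 / 2 + Real.log (r * Λ)))) := by
        rw [← Real.exp_nat_mul]; ring_nf
      _ ≤ Real.exp (a ^ 2 / 64) := by
        rw [Real.exp_le_exp]
        have := mul_le_mul_of_nonneg_left e2 (Nat.cast_nonneg (α := ℝ) s)
        linarith
  classical
  set B : EuclideanSpace ℝ (Fin s) → Finset (EuclideanSpace ℝ (Fin s)) :=
    fun c => Z.filter fun z => ‖z - c‖ ≤ Λ⁻¹
  have hcell (c) (hc : c ∈ C) :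
      gaussianPi (Fin n) {g | ∃ z ∈ B c, a < ∑ i, g i * (net.eval z i - net.eval zbar i)} ≤
        2 * ENNReal.ofReal (Real.exp (-(a ^ 2 / 32))) := by
    set t := a / 16
    have ht : 0 ≤ t := by positivity
    have h1 := net.gaussianExpSup_eval_le hw hW hφ le_rfl hd (B c) c (ρ := Λ⁻¹)
      (fun z hz => (Finset.mem_filter.1 hz).2) (t := 2 * t) (by positivity)
    rw [← hΛ, mul_assoc, mul_inv_cancel₀ hΛ0.ne', mul_one] at h1
    have h2 := gaussianExpSup_le_of_decomposition (B c)
      (fun z i => t * (net.eval z i - net.eval zbar i))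
      (fun z i => t * (net.eval z i - net.eval c i))
      (fun i => t * (net.eval c i - net.eval zbar i)) (fun z i => by ring)
    simp only [← mul_assoc] at h2
    have h3 : ∑ i, (t * (net.eval c i - net.eval zbar i)) ^ 2 ≤ 4 * t ^ 2 := by
      have e : ∑ i, (t * (net.eval c i - net.eval zbar i)) ^ 2 =
          t ^ 2 * ‖net.eval c - net.eval zbar‖ ^ 2 := by
        simp [EuclideanSpace.norm_sq_eq, mul_pow, Finset.mul_sum]
      have : ‖net.eval c - net.eval zbar‖ ≤ 2 := by
        linarith [norm_sub_le (net.eval c) (net.eval zbar), (hZ c (hCZ hc)).2, hzbar.2]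
      rw [e]
      nlinarith [pow_le_pow_left₀ (norm_nonneg _) this 2, sq_nonneg t]
    have h4 : gaussianExpSup (B c) (fun z i => t * (net.eval z i - net.eval zbar i)) ≤
        2 * ENNReal.ofReal (Real.exp (8 * t ^ 2)) := by
      have k1 : ENNReal.ofReal (Real.exp ((2 * t) ^ 2)) ≤ ENNReal.ofReal (Real.exp (8 * t ^ 2)) := by
        gcongr
        nlinarith [sq_nonneg t]
      have k2 : ENNReal.ofReal (Real.exp (2 * ∑ i, (t * (net.eval c i - net.eval zbar i)) ^ 2)) ≤
          ENNReal.ofReal (Real.exp (8 * t ^ 2)) := by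
        refine ENNReal.ofReal_le_ofReal (Real.exp_le_exp.2 ?_)
        linarith
      set X := ENNReal.ofReal (Real.exp (8 * t ^ 2))
      calc _ ≤ 2⁻¹ * (2 * X + X) := h2.trans (by
            gcongr
            exact h1.trans (by gcongr))
        _ ≤ 2⁻¹ * (2 * X + 2 * X) := by
            gcongr
            exact le_mul_of_one_le_left' (by norm_num)
        _ = 2 * X := by
            rw [← two_mul, ← mul_assoc, ENNReal.inv_mul_cancel (by simp) (by simp), one_mul]
    refine (gaussianPi_exists_lt_le_of_expSup_le (B c) _ ht h4).trans (le_of_eq ?_)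
    congr 3
    simp only [t]
    ring
  have hsub : {g : Fin n → ℝ | ∃ z ∈ Z, a < ∑ i, g i * (net.eval z i - net.eval zbar i)} ⊆
      ⋃ c ∈ C, {g | ∃ z ∈ B c, a < ∑ i, g i * (net.eval z i - net.eval zbar i)} := by
    rintro g ⟨z, hz, hlt⟩
    obtain ⟨c, hc, hzc⟩ := hcov z hz
    exact Set.mem_biUnion hc ⟨z, Finset.mem_filter.2 ⟨hz, hzc⟩, hlt⟩
  calc _ ≤ ∑ c ∈ C, gaussianPi (Fin n)
          {g | ∃ z ∈ B c, a < ∑ i, g i * (net.eval z i - net.eval zbar i)} :=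
        (measure_mono hsub).trans (measure_biUnion_finset_le _ _)
    _ ≤ ∑ _c ∈ C, 2 * ENNReal.ofReal (Real.exp (-(a ^ 2 / 32))) := Finset.sum_le_sum hcell
    _ = ENNReal.ofReal C.card * (2 * ENNReal.ofReal (Real.exp (-(a ^ 2 / 32)))) := by
        rw [Finset.sum_const, nsmul_eq_mul, ENNReal.ofReal_natCast]
    _ ≤ ENNReal.ofReal (Real.exp (a ^ 2 / 64)) *
          (2 * ENNReal.ofReal (Real.exp (-(a ^ 2 / 32)))) := by gcongr
    _ = _ := by
        rw [mul_left_comm, ← ENNReal.ofReal_mul (Real.exp_pos _).le, ← Real.exp_add]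
        congr 3
        ring

end FeedforwardNetwork

lemma integral_abs_gaussianReal : ∫ x, |x| ∂gaussianReal 0 1 = √(2 / Real.pi) := by
  rw [integral_gaussianReal_eq_integral_smul one_ne_zero]
  have h1 : ∀ x : ℝ, gaussianPDFReal 0 1 x • |x| =
      (fun y => (√(2 * Real.pi))⁻¹ * (y * Real.exp (-(1 / 2) * y ^ 2))) |x| := fun x => by
    simp only [gaussianPDFReal, NNReal.coe_one, mul_one, sub_zero, sq_abs, smul_eq_mul]
    ring_nf
  simp_rw [h1]
  rw [integral_comp_abs (f := fun y => (√(2 * Real.pi))⁻¹ * (y * Real.exp (-(1 / 2) * y ^ 2))),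
    integral_const_mul]
  have h2 : ∫ y in Set.Ioi (0 : ℝ), y * Real.exp (-(1 / 2) * y ^ 2) = 1 := by
    have h := integral_mul_cexp_neg_mul_sq (b := 1 / 2) (by norm_num)
    have h3 : ∀ y : ℝ, (y : ℂ) * Complex.exp (-(1 / 2) * (y : ℂ) ^ 2) =
        ((y * Real.exp (-(1 / 2) * y ^ 2) : ℝ) : ℂ) := fun y => by push_cast; rfl
    simp_rw [h3] at h
    rw [integral_complex_ofReal] at h
    have h' : ∫ y in Set.Ioi (0 : ℝ), y * Real.exp (-(1 / 2) * y ^ 2) = (2 * (1 / 2))⁻¹ := by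
      apply Complex.ofReal_injective
      rw [h]
      push_cast
      rfl
    simpa using h'
  rw [h2, mul_one, Real.sqrt_mul (by norm_num), Real.sqrt_div (by norm_num)]
  have : √(2 : ℝ) ^ 2 = 2 := Real.sq_sqrt (by norm_num)
  field_simp
  linarith

/-- A random variable whose absolute value is that of a standard Gaussian is sub-Gaussian after
centering. -/
lemma hasSubgaussianMGF_sub_integral_of_abs_eq {Ω : Type*} [MeasurableSpace Ω] {μ : Measure Ω}
    [IsProbabilityMeasure μ] {X Y : Ω → ℝ} (hX : Measurable X)
    (hlaw : μ.map Y = gaussianReal 0 1) (h : ∀ ω, |X ω| = |Y ω|) :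
    HasSubgaussianMGF (fun ω => X ω - ∫ ω', X ω' ∂μ) 2 μ := by
  have hYm : AEMeasurable Y μ := .of_map_ne_zero (by simp [hlaw, NeZero.ne])
  have hYi (t : ℝ) : Integrable (fun ω => Real.exp (t * Y ω)) μ := by
    have := integrable_exp_mul_gaussianReal (μ := 0) (v := 1) t
    rw [← hlaw] at this
    exact this.comp_aemeasurable hYm
  have hpt (t : ℝ) (ω : Ω) : Real.exp (t * X ω) + Real.exp (-t * X ω) =
      Real.exp (t * Y ω) + Real.exp (-t * Y ω) := by
    rcases abs_eq_abs.1 (h ω) with e | e <;> rw [e]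
    rw [mul_neg, mul_neg, neg_mul, neg_neg, add_comm]
  have hXi (t : ℝ) : Integrable (fun ω => Real.exp (t * X ω)) μ := by
    refine ((hYi t).add (hYi (-t))).mono' (by fun_prop) (ae_of_all _ fun ω => ?_)
    rw [Real.norm_eq_abs, abs_of_pos (Real.exp_pos _), Pi.add_apply, ← hpt]
    linarith [Real.exp_pos (-t * X ω)]
  have hXint : Integrable X μ := by
    refine (((hXi 1).add (hXi (-1)))).mono' (by fun_prop) (ae_of_all _ fun ω => ?_)
    have h1 := Real.add_one_le_exp (1 * X ω)
    have h2 := Real.add_one_le_exp (-1 * X ω)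
    rw [Real.norm_eq_abs, Pi.add_apply]
    have h3 := Real.exp_pos (1 * X ω)
    have h4 := Real.exp_pos (-1 * X ω)
    rcases abs_cases (X ω) with h | h <;> linarith
  have hsum (t : ℝ) : mgf X μ t + mgf X μ (-t) = 2 * Real.exp (t ^ 2 / 2) := by
    rw [mgf, mgf, ← integral_add (hXi t) (hXi (-t))]
    simp_rw [hpt]
    rw [integral_add (hYi t) (hYi (-t))]
    have e (u : ℝ) : ∫ ω, Real.exp (u * Y ω) ∂μ = Real.exp (u ^ 2 / 2) := by
      simpa [mgf] using mgf_gaussianReal hlaw u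
    rw [e, e]
    ring_nf
  have hjensen (t : ℝ) : Real.exp (t * ∫ ω, X ω ∂μ) ≤ mgf X μ t := by
    have := convexOn_exp.map_integral_le (μ := μ) (f := fun ω => t * X ω)
      Real.continuous_exp.continuousOn isClosed_univ (by simp) (hXint.const_mul t) (hXi t)
    rwa [integral_const_mul] at this
  have hmul (t : ℝ) (ω : Ω) : Real.exp (t * (X ω - ∫ ω', X ω' ∂μ)) =
      Real.exp (t * X ω) * Real.exp (-t * ∫ ω', X ω' ∂μ) := by
    rw [← Real.exp_add]; ring_nf
  refine ⟨fun t => ?_, fun t => ?_⟩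
  · simp_rw [hmul]
    exact (hXi t).mul_const _
  · rw [mgf]
    simp_rw [hmul]
    rw [integral_mul_const]
    change mgf X μ t * _ ≤ _
    calc mgf X μ t * Real.exp (-t * ∫ ω', X ω' ∂μ) ≤ mgf X μ t * mgf X μ (-t) :=
          mul_le_mul_of_nonneg_left (hjensen _) mgf_nonneg
      _ ≤ ((mgf X μ t + mgf X μ (-t)) / 2) ^ 2 := by
          nlinarith [sq_nonneg (mgf X μ t - mgf X μ (-t))]
      _ = Real.exp ((2 : ℝ≥0) * t ^ 2 / 2) := by
          rw [hsum, mul_div_cancel_left₀ _ two_ne_zero, ← Real.exp_nat_mul]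
          congr 1
          push_cast
          ring

lemma hasSubgaussianMGF_of_map_eq_gaussianReal {Ω : Type*} [MeasurableSpace Ω] {μ : Measure Ω}
    {Y : Ω → ℝ} (hlaw : μ.map Y = gaussianReal 0 1) : HasSubgaussianMGF Y 1 μ := by
  have hYm : AEMeasurable Y μ := .of_map_ne_zero (by simp [hlaw, NeZero.ne])
  refine ⟨fun t => ?_, fun t => ?_⟩
  · have := integrable_exp_mul_gaussianReal (μ := 0) (v := 1) t
    rw [← hlaw] at this
    exact this.comp_aemeasurable hYm
  · rw [mgf_gaussianReal hlaw]
    simp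

lemma measurePreserving_ite {V : Type*} [MeasurableSpace V] {γ : Measure V}
    {R : V → V} (hR : MeasurePreserving R γ γ) {S : Set V} (hS : MeasurableSet S)
    [DecidablePred (· ∈ S)] (hRS : ∀ a, R a ∈ S ↔ a ∈ S) :
    MeasurePreserving (fun a => if a ∈ S then a else R a) γ γ := by
  have hm : Measurable fun a => if a ∈ S then a else R a :=
    Measurable.ite hS measurable_id hR.measurable
  refine ⟨hm, ?_⟩
  ext B hB
  rw [Measure.map_apply hm hB, ← measure_inter_add_sdiff _ hS, ← measure_inter_add_sdiff B hS,
    ← hR.measure_preimage (hB.diff hS).nullMeasurableSet]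
  congr 2
  · ext a
    simp only [Set.mem_inter_iff, Set.mem_preimage]
    exact and_congr_left fun h => by rw [if_pos h]
  · ext a
    simp only [Set.mem_sdiff, Set.mem_preimage, hRS]
    exact and_congr_left fun h => by rw [if_neg h]

lemma measurable_signPM : Measurable signPM :=
  Measurable.ite measurableSet_Ioi measurable_const measurable_const

lemma signPM_mul_abs (p : ℝ) : signPM p * |p| = p := by
  unfold signPM
  split_ifs with h
  · rw [abs_of_pos h, one_mul]
  · rw [abs_of_nonpos (not_lt.1 h)]
    ring

lemma signPM_eq (p : ℝ) : signPM p = 1 ∨ signPM p = -1 := by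
  unfold signPM
  split_ifs <;> simp

section Rows

variable {V : Type*} [NormedAddCommGroup V] [InnerProductSpace ℝ V]

/-- Reflects the row `a` across the line `ℝ x` if the measurement `e * sign ⟪x, a⟫` is not `1`. -/
noncomputable def reflectRow (x : V) (q : ℝ × V) : ℝ × V :=
  (q.1, if q.1 * signPM ⟪x, q.2⟫_ℝ = 1 then q.2 else (ℝ ∙ x).reflection q.2)

lemma inner_reflection_singleton {x : V} (hx : ‖x‖ = 1) (a : V) :
    (ℝ ∙ x).reflection a = (2 * ⟪x, a⟫_ℝ) • x - a := by
  rw [Submodule.reflection_singleton_apply, hx]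
  simp [two_smul, two_mul, add_smul]

lemma inner_self_reflection (x a : V) : ⟪x, (ℝ ∙ x).reflection a⟫_ℝ = ⟪x, a⟫_ℝ := by
  have h : (ℝ ∙ x).reflection x = x :=
    Submodule.reflection_mem_subspace_eq_self (Submodule.mem_span_singleton_self x)
  have h' := (ℝ ∙ x).reflection.inner_map_map x a
  rwa [h] at h'

lemma measurement_mul_inner_eq {x : V} (hx : ‖x‖ = 1) (q : ℝ × V) (hq : q.1 = 1 ∨ q.1 = -1)
    (v : V) :
    q.1 * signPM ⟪x, q.2⟫_ℝ * ⟪q.2, v⟫_ℝ = ⟪(reflectRow x q).2, v⟫_ℝ +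
      ((reflectRow x q).1 * |⟪x, (reflectRow x q).2⟫_ℝ| - ⟪x, (reflectRow x q).2⟫_ℝ) *
        ⟪x, v⟫_ℝ := by
  obtain ⟨e, a⟩ := q
  have hs := signPM_eq ⟪x, a⟫_ℝ
  have ha := signPM_mul_abs ⟪x, a⟫_ℝ
  simp only [reflectRow] at *
  split_ifs with h
  · have he : e * |⟪x, a⟫_ℝ| = ⟪x, a⟫_ℝ := by
      rcases hq with rfl | rfl <;> rcases hs with hs | hs <;> rw [hs] at ha h <;> linarith
    rw [h, he]
    ring
  · have h' : e * signPM ⟪x, a⟫_ℝ = -1 := by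
      rcases hq with rfl | rfl <;> rcases hs with hs | hs <;> rw [hs] at h ⊢ <;>
        first | (norm_num; done) | exact absurd (by norm_num) h
    have he : e * |⟪x, a⟫_ℝ| = -⟪x, a⟫_ℝ := by
      rcases hq with rfl | rfl <;> rcases hs with hs | hs <;> rw [hs] at ha h' <;> linarith
    rw [h', inner_self_reflection, he, inner_reflection_singleton hx, inner_sub_left,
      inner_smul_left]
    simp only [conj_trivial]
    ring

variable [FiniteDimensional ℝ V] [MeasurableSpace V] [BorelSpace V]

lemma measurePreserving_reflectRow (x : V) (ν : Measure ℝ) [IsProbabilityMeasure ν] :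
    MeasurePreserving (reflectRow x) (ν.prod (stdGaussian V)) (ν.prod (stdGaussian V)) := by
  classical
  have hset : MeasurableSet {q : ℝ × V | q.1 * signPM ⟪x, q.2⟫_ℝ = 1} := by
    have := measurable_signPM.comp (f := fun q : ℝ × V => ⟪x, q.2⟫_ℝ) (by fun_prop)
    exact (measurable_fst.mul this) (measurableSet_singleton 1)
  have hR : Measurable fun a : V => (ℝ ∙ x).reflection a :=
    (ℝ ∙ x).reflection.continuous.measurable
  refine (MeasurePreserving.id ν).skew_product
    (g := fun e a => if e * signPM ⟪x, a⟫_ℝ = 1 then a else (ℝ ∙ x).reflection a) ?_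
    (ae_of_all _ fun e => ?_)
  · exact Measurable.ite hset measurable_snd (hR.comp measurable_snd)
  · refine (measurePreserving_ite (γ := stdGaussian V) (R := (ℝ ∙ x).reflection)
      ⟨hR, stdGaussian_map _⟩ (S := {a | e * signPM ⟪x, a⟫_ℝ = 1})
      (measurable_prodMk_left hset) fun a => ?_).map_eq
    simp only [Set.mem_ofPred_eq, inner_self_reflection]

lemma map_inner_stdGaussian {x : V} (hx : ‖x‖ = 1) :
    (stdGaussian V).map (fun a => ⟪x, a⟫_ℝ) = gaussianReal 0 1 := by
  have h := IsGaussian.map_eq_gaussianReal (μ := stdGaussian V) (innerSL ℝ x)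
  rw [variance_dual_stdGaussian, integral_strongDual_stdGaussian, innerSL_apply_norm, hx] at h
  simpa using h

end Rows

lemma measurePreserving_pi_curry {ι κ X : Type*} [Fintype ι] [Fintype κ] [MeasurableSpace X]
    (μ : ι → κ → Measure X) [∀ i j, IsProbabilityMeasure (μ i j)] :
    MeasurePreserving (fun (g : ι × κ → X) i j => g (i, j))
      (Measure.pi fun p : ι × κ => μ p.1 p.2) (Measure.pi fun i => Measure.pi (μ i)) := by
  refine ⟨by fun_prop, ?_⟩
  have h := Measure.infinitePi_map_curry μ
  simp only [Measure.infinitePi_eq_pi] at h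
  exact h

section Model

variable {m n : ℕ} {Ω : Type*} [MeasurableSpace Ω] {μ : Measure Ω} [IsProbabilityMeasure μ]
  {A : Ω → Matrix (Fin m) (Fin n) ℝ} {η : Ω → Fin m → ℝ}

lemma map_rows_eq_pi (hA : ∀ i j, Measurable fun ω => A ω i j)
    (hAlaw : ∀ i j, μ.map (fun ω => A ω i j) = gaussianReal 0 1)
    (hη : ∀ i, Measurable fun ω => η ω i)
    (hind : iIndepFun (fun (k : (Fin m × Fin n) ⊕ Fin m) (ω : Ω) =>
          Sum.elim (fun ij => A ω ij.1 ij.2) (fun i => η ω i) k) μ) :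
    μ.map (fun ω i => (η ω i, (WithLp.toLp 2 (A ω i) : EuclideanSpace ℝ (Fin n)))) =
      Measure.pi fun i => (μ.map fun ω => η ω i).prod (stdGaussian (EuclideanSpace ℝ (Fin n))) := by
  have (i : Fin m) : IsProbabilityMeasure (μ.map fun ω => η ω i) :=
    Measure.isProbabilityMeasure_map (hη i).aemeasurable
  have hmeas (k : (Fin m × Fin n) ⊕ Fin m) : Measurable fun ω =>
      Sum.elim (fun ij : Fin m × Fin n => A ω ij.1 ij.2) (fun i => η ω i) k := by
    rcases k with ij | i
    exacts [hA _ _, hη i]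
  have hlaw := (iIndepFun_iff_map_fun_eq_pi_map fun k => (hmeas k).aemeasurable).1 hind
  set κ : (Fin m × Fin n) ⊕ Fin m → Measure ℝ := fun k => μ.map fun ω =>
      Sum.elim (fun ij : Fin m × Fin n => A ω ij.1 ij.2) (fun i => η ω i) k
  have hκ (k) : IsProbabilityMeasure (κ k) := Measure.isProbabilityMeasure_map (hmeas k).aemeasurable
  have f1 := measurePreserving_sumPiEquivProdPi κ
  have f2 : MeasurePreserving
      (fun (g : Fin m × Fin n → ℝ) i => (WithLp.toLp 2 fun j => g (i, j) : EuclideanSpace ℝ (Fin n)))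
      (Measure.pi fun p => κ (.inl p)) (Measure.pi fun _ => stdGaussian _) := by
    have h1 : (fun p : Fin m × Fin n => κ (.inl p)) = fun p => gaussianReal 0 1 :=
      funext fun p => hAlaw p.1 p.2
    rw [h1]
    exact (measurePreserving_pi _ _ fun _ => ⟨by fun_prop, map_pi_eq_stdGaussian⟩).comp
      (measurePreserving_pi_curry fun (_ : Fin m) (_ : Fin n) => gaussianReal 0 1)
  have f3 := (measurePreserving_arrowProdEquivProdArrow ℝ (EuclideanSpace ℝ (Fin n)) (Fin m)
    (fun i => μ.map fun ω => η ω i) (fun _ => stdGaussian _)).symm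
  have f := f3.comp (Measure.measurePreserving_swap.comp ((f2.prod (MeasurePreserving.id
    (Measure.pi fun i => κ (.inr i)))).comp f1))
  have hX : MeasurePreserving (fun ω (k : (Fin m × Fin n) ⊕ Fin m) =>
      Sum.elim (fun ij : Fin m × Fin n => A ω ij.1 ij.2) (fun i => η ω i) k) μ (Measure.pi κ) :=
    ⟨measurable_pi_iff.2 hmeas, hlaw⟩
  exact (f.comp hX).map_eq

lemma map_normalized_column_sums (hm : 0 < m) (hA : ∀ i j, Measurable fun ω => A ω i j)
    (hAlaw : ∀ i j, μ.map (fun ω => A ω i j) = gaussianReal 0 1)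
    (hind : iIndepFun (fun (ij : Fin m × Fin n) (ω : Ω) => A ω ij.1 ij.2) μ) :
    MeasurePreserving (fun ω j => ∑ i, A ω i j * (√m)⁻¹) μ (gaussianPi (Fin n)) := by
  have h1 : MeasurePreserving (fun ω (p : Fin n × Fin m) => A ω p.2 p.1) μ
      (gaussianPi (Fin n × Fin m)) := by
    refine ⟨measurable_pi_iff.2 fun p => hA _ _, ?_⟩
    have := (iIndepFun_iff_map_fun_eq_pi_map fun p : Fin n × Fin m =>
      (hA p.2 p.1).aemeasurable).1 (hind.precomp (g := Prod.swap) Prod.swap_injective)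
    rw [this]
    simp only [hAlaw]
  have h2 : MeasurePreserving (fun g : Fin m → ℝ => ∑ i, g i * (√m)⁻¹) (gaussianPi (Fin m))
      (gaussianReal 0 1) := by
    refine ⟨by fun_prop, ?_⟩
    rw [map_gaussianPi_sum_mul fun _ => (√m)⁻¹]
    congr 1
    rw [Finset.sum_const, Finset.card_univ, Fintype.card_fin, nsmul_eq_mul, inv_pow,
      Real.sq_sqrt (Nat.cast_nonneg _), mul_inv_cancel₀ (by positivity), Real.toNNReal_one]
  exact ((measurePreserving_pi _ _ fun _ => h2).comp
    (measurePreserving_pi_curry fun (_ : Fin n) (_ : Fin m) => gaussianReal 0 1)).comp h1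

lemma integral_sign_flip {i : Fin m} {α : ℝ} (hα : 1 / 2 < α) (hη : Measurable fun ω => η ω i)
    (hηv : ∀ ω, η ω i = 1 ∨ η ω i = -1) (hηα : μ {ω | η ω i = 1} = ENNReal.ofReal α) :
    ∫ ω, η ω i ∂μ = 2 * α - 1 := by
  have hS : MeasurableSet {ω | η ω i = 1} := hη (measurableSet_singleton 1)
  have h : (fun ω => η ω i) = fun ω => 2 * {ω | η ω i = 1}.indicator (fun _ => (1 : ℝ)) ω - 1 := by
    funext ω
    by_cases h1 : η ω i = 1
    · rw [Set.indicator_of_mem (by exact h1), h1]; norm_num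
    · rw [Set.indicator_of_notMem (by exact h1), (hηv ω).resolve_left h1]; norm_num
  rw [h, integral_sub ((integrable_indicator_iff hS).2 (integrableOn_const) |>.const_mul 2)
    (integrable_const 1), integral_const_mul, integral_indicator_const _ hS, measureReal_def, hηα,
    ENNReal.toReal_ofReal (by linarith)]
  simp

/-- Concentration of the part of the measurements along the signal. -/
lemma measure_abs_sum_flip_ge_le {V : Type*} [NormedAddCommGroup V] [InnerProductSpace ℝ V]
    [FiniteDimensional ℝ V] [MeasurableSpace V] [BorelSpace V] {X : Ω → Fin m → ℝ × V} {x : V}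
    {ν : Fin m → Measure ℝ} [∀ i, IsProbabilityMeasure (ν i)] {β : ℝ}
    (hx : ‖x‖ = 1) (hX : Measurable X)
    (hlaw : μ.map X = Measure.pi fun i => (ν i).prod (stdGaussian V))
    (hη : ∀ ω i, (X ω i).1 = 1 ∨ (X ω i).1 = -1) (hβ : ∀ i, ∫ ω, (X ω i).1 ∂μ = β)
    {τ : ℝ} (hτ : 0 ≤ τ) :
    μ {ω | τ ≤ |∑ i, ((X ω i).1 * |⟪x, (X ω i).2⟫_ℝ| - ⟪x, (X ω i).2⟫_ℝ - β * √(2 / Real.pi))|} ≤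
      2 * ENNReal.ofReal (Real.exp (-(τ ^ 2 / (12 * m)))) := by
  have hXi (i : Fin m) : Measurable fun ω => X ω i := (measurable_pi_apply i).comp hX
  have hrow (i : Fin m) : MeasurePreserving (fun ω => X ω i) μ ((ν i).prod (stdGaussian V)) :=
    (measurePreserving_eval (fun i => (ν i).prod (stdGaussian V)) i).comp ⟨hX, hlaw⟩
  have hinner : Measurable fun a : V => ⟪x, a⟫_ℝ := by fun_prop
  have hp (i : Fin m) : μ.map (fun ω => ⟪x, (X ω i).2⟫_ℝ) = gaussianReal 0 1 :=
    ((MeasurePreserving.mk hinner (map_inner_stdGaussian hx)).comp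
      (measurePreserving_snd.comp (hrow i))).map_eq
  have hindep : iIndepFun (fun i ω => X ω i) μ := by
    rw [iIndepFun_iff_map_fun_eq_pi_map fun i => (hXi i).aemeasurable]
    simp only [(hrow _).map_eq]
    exact hlaw
  have hpair (i : Fin m) : IndepFun (fun ω => (X ω i).1) (fun ω => |⟪x, (X ω i).2⟫_ℝ|) μ := by
    have : IndepFun (fun ω => (X ω i).1) (fun ω => (X ω i).2) μ := by
      have e1 : μ.map (fun ω => (X ω i).1) = ν i := (measurePreserving_fst.comp (hrow i)).map_eq
      have e2 : μ.map (fun ω => (X ω i).2) = stdGaussian V :=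
        (measurePreserving_snd.comp (hrow i)).map_eq
      rw [indepFun_iff_map_prod_eq_prod_map_map (by fun_prop) (by fun_prop), e1, e2]
      exact (hrow i).map_eq
    exact this.comp measurable_id (ψ := fun a => |⟪x, a⟫_ℝ|) (by fun_prop)
  have hmean (i : Fin m) : ∫ ω, (X ω i).1 * |⟪x, (X ω i).2⟫_ℝ| ∂μ = β * √(2 / Real.pi) := by
    rw [(hpair i).integral_fun_mul_eq_mul_integral (by fun_prop) (by fun_prop), hβ,
      ← integral_abs_gaussianReal, ← hp i, integral_map (by fun_prop) (by fun_prop)]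
  have hsub (i : Fin m) : HasSubgaussianMGF (fun ω => (X ω i).1 * |⟪x, (X ω i).2⟫_ℝ| -
      ⟪x, (X ω i).2⟫_ℝ - β * √(2 / Real.pi)) 6 μ := by
    have h1 := hasSubgaussianMGF_sub_integral_of_abs_eq
      (X := fun ω => (X ω i).1 * |⟪x, (X ω i).2⟫_ℝ|) (by fun_prop) (hp i) fun ω => by
        rcases hη ω i with h | h <;> simp [h]
    rw [hmean] at h1
    have h2 := (hasSubgaussianMGF_of_map_eq_gaussianReal (hp i)).neg
    have h3 := h1.add h2
    refine ⟨fun t => ?_, fun t => ?_⟩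
    · convert! h3.integrable_exp_mul t using 4
      simp only [Pi.neg_apply]
      ring
    · have h4 := h3.mgf_le t
      have h5 : (((NNReal.sqrt 2 + NNReal.sqrt 1) ^ 2 : ℝ≥0) : ℝ) ≤ 6 := by
        push_cast
        have e1 : √(2 : ℝ) ^ 2 = 2 := Real.sq_sqrt (by norm_num)
        have e2 : √(2 : ℝ) ≤ 3 / 2 := Real.sqrt_le_iff.2 ⟨by norm_num, by norm_num⟩
        rw [Real.sqrt_one]
        nlinarith
      calc mgf (fun ω => (X ω i).1 * |⟪x, (X ω i).2⟫_ℝ| - ⟪x, (X ω i).2⟫_ℝ -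
              β * √(2 / Real.pi)) μ t = _ := by
            congr 1
            funext ω
            simp only [Pi.neg_apply]
            ring
        _ ≤ _ := h4
        _ ≤ _ := by
          gcongr
          exact_mod_cast h5
  have hindU : iIndepFun (fun i ω => (X ω i).1 * |⟪x, (X ω i).2⟫_ℝ| -
      ⟪x, (X ω i).2⟫_ℝ - β * √(2 / Real.pi)) μ :=
    hindep.comp (fun _ q => q.1 * |⟪x, q.2⟫_ℝ| - ⟪x, q.2⟫_ℝ - β * √(2 / Real.pi))
      (fun _ => by fun_prop)
  have hS := HasSubgaussianMGF.sum_of_iIndepFun hindU (s := Finset.univ) fun i _ => hsub i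
  have t1 := hS.measure_ge_le hτ
  have t2 := hS.neg.measure_ge_le hτ
  have hc : -τ ^ 2 / (2 * ((∑ _i : Fin m, (6 : ℝ≥0) : ℝ≥0) : ℝ)) = -(τ ^ 2 / (12 * m)) := by
    simp
    ring
  rw [hc] at t1 t2
  set U : Ω → ℝ := fun ω => ∑ i, ((X ω i).1 * |⟪x, (X ω i).2⟫_ℝ| -
      ⟪x, (X ω i).2⟫_ℝ - β * √(2 / Real.pi))
  have hsubset : {ω | τ ≤ |U ω|} ⊆ {ω | τ ≤ U ω} ∪ {ω | τ ≤ (-U) ω} := by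
    intro ω h
    rcases le_abs.1 (show τ ≤ |U ω| from h) with h | h
    exacts [Or.inl h, Or.inr h]
  refine (measure_mono hsubset).trans ((measure_union_le _ _).trans ?_)
  rw [two_mul]
  refine add_le_add ?_ ?_
  · rw [← ofReal_measureReal]
    exact ENNReal.ofReal_le_ofReal t1
  · rw [← ofReal_measureReal]
    exact ENNReal.ofReal_le_ofReal t2

end Model

lemma measure_exists_mem_lt_le {Ω E : Type*} [MeasurableSpace Ω] {μ : Measure Ω}
    [TopologicalSpace E] [SecondCountableTopology E] {S : Set E} {f : E → Ω → ℝ} {a : ℝ} {b : ℝ≥0∞}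
    (hf : ∀ ω, Continuous fun z => f z ω)
    (h : ∀ Z : Finset E, (∀ z ∈ Z, z ∈ S) → μ {ω | ∃ z ∈ Z, a < f z ω} ≤ b) :
    μ {ω | ∃ z ∈ S, a < f z ω} ≤ b := by
  classical
  rcases S.eq_empty_or_nonempty with rfl | hS
  · simp
  have : Nonempty S := hS.to_subtype
  set d : ℕ → S := TopologicalSpace.denseSeq S
  set Z : ℕ → Finset E := fun k => (Finset.range k).image fun i => (d i : E)
  have hmono : Monotone fun k => {ω | ∃ z ∈ Z k, a < f z ω} := by
    intro k l hkl ω ⟨z, hz, hlt⟩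
    exact ⟨z, Finset.image_subset_image (Finset.range_mono hkl) hz, hlt⟩
  have heq : {ω | ∃ z ∈ S, a < f z ω} ⊆ ⋃ k, {ω | ∃ z ∈ Z k, a < f z ω} := by
    rintro ω ⟨z, hz, hlt⟩
    have hopen : IsOpen {y : S | a < f y ω} :=
      isOpen_lt continuous_const ((hf ω).comp continuous_subtype_val)
    obtain ⟨i, hi⟩ := (TopologicalSpace.denseRange_denseSeq S).exists_mem_open hopen ⟨⟨z, hz⟩, hlt⟩
    exact Set.mem_iUnion.2 ⟨i + 1, d i, Finset.mem_image.2 ⟨i, by simp, rfl⟩, hi⟩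
  refine (measure_mono heq).trans ?_
  rw [hmono.measure_iUnion]
  refine iSup_le fun k => h _ fun z hz => ?_
  obtain ⟨i, _, rfl⟩ := Finset.mem_image.1 hz
  exact (d i).2

/-- In distribution, the signs of the measurements can be absorbed into the Gaussian rows, up to a
scalar correction along the signal. -/
lemma measure_exists_lt_measurement_eq {m : ℕ} {Ω κ V : Type*} [MeasurableSpace Ω] {μ : Measure Ω}
    [NormedAddCommGroup V] [InnerProductSpace ℝ V]
    [FiniteDimensional ℝ V] [MeasurableSpace V] [BorelSpace V] {X : Ω → Fin m → ℝ × V} {x : V}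
    {ν : Fin m → Measure ℝ} [∀ i, IsProbabilityMeasure (ν i)]
    (hx : ‖x‖ = 1) (hX : Measurable X)
    (hlaw : μ.map X = Measure.pi fun i => (ν i).prod (stdGaussian V))
    (hη : ∀ ω i, (X ω i).1 = 1 ∨ (X ω i).1 = -1)
    (Z : Finset κ) (v : κ → V) (b : κ → ℝ) (c a : ℝ) :
    μ {ω | ∃ z ∈ Z, a < c * ∑ i, (X ω i).1 * signPM ⟪x, (X ω i).2⟫_ℝ * ⟪(X ω i).2, v z⟫_ℝ - b z} =
      μ {ω | ∃ z ∈ Z, a < c * (∑ i, ⟪(X ω i).2, v z⟫_ℝ +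
        (∑ i, ((X ω i).1 * |⟪x, (X ω i).2⟫_ℝ| - ⟪x, (X ω i).2⟫_ℝ)) * ⟪x, v z⟫_ℝ) - b z} := by
  set B : Set (Fin m → ℝ × V) := {q | ∃ z ∈ Z, a < c * (∑ i, ⟪(q i).2, v z⟫_ℝ +
        (∑ i, ((q i).1 * |⟪x, (q i).2⟫_ℝ| - ⟪x, (q i).2⟫_ℝ)) * ⟪x, v z⟫_ℝ) - b z}
  have hB : MeasurableSet B := by
    have : B = ⋃ z ∈ Z, {q | a < c * (∑ i, ⟪(q i).2, v z⟫_ℝ +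
        (∑ i, ((q i).1 * |⟪x, (q i).2⟫_ℝ| - ⟪x, (q i).2⟫_ℝ)) * ⟪x, v z⟫_ℝ) - b z} := by
      ext q
      simp [B]
    rw [this]
    refine Finset.measurableSet_biUnion _ fun z _ => measurableSet_lt measurable_const ?_
    fun_prop
  have hT := measurePreserving_pi (fun i => (ν i).prod (stdGaussian V))
    (fun i => (ν i).prod (stdGaussian V)) fun i => measurePreserving_reflectRow x (ν i)
  have hXp : MeasurePreserving X μ (Measure.pi fun i => (ν i).prod (stdGaussian V)) := ⟨hX, hlaw⟩
  have h1 := (hT.comp hXp).measure_preimage hB.nullMeasurableSet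
  have h2 := hXp.measure_preimage hB.nullMeasurableSet
  refine Eq.trans ?_ (h1.trans h2.symm)
  congr 1
  ext ω
  simp only [Set.mem_ofPred_eq, Set.mem_preimage, Function.comp_apply, B]
  refine exists_congr fun z => and_congr_right fun _ => ?_
  rw [Finset.sum_congr rfl fun i _ => measurement_mul_inner_eq hx (X ω i) (hη ω i) (v z),
    Finset.sum_add_distrib, Finset.sum_mul]

lemma sqrt_two_pi_le_three : √(2 * Real.pi) ≤ 3 :=
  Real.sqrt_le_iff.2 ⟨by norm_num, by linarith [Real.pi_lt_d2]⟩

lemma mulVec_apply_eq_inner {m n : ℕ} (A : Matrix (Fin m) (Fin n) ℝ)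
    (x : EuclideanSpace ℝ (Fin n)) (i : Fin m) :
    (A *ᵥ x.ofLp) i = ⟪(WithLp.toLp 2 (A i) : EuclideanSpace ℝ (Fin n)), x⟫_ℝ := by
  simp [mulVec, dotProduct, PiLp.inner_apply, mul_comm]

section Model

variable {s m n : ℕ} {Ω : Type*} [MeasurableSpace Ω] {μ : Measure Ω} [IsProbabilityMeasure μ]
  {A : Ω → Matrix (Fin m) (Fin n) ℝ} {η : Ω → Fin m → ℝ}

/-- Uniform deviation of the measurements from their mean, over finitely many latent vectors. -/
theorem measure_exists_deviation_le {L : ℝ≥0} {w r ε α : ℝ} (hL : 0 < L) (hw : 0 < w)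
    (hε : 0 < ε) (hα : 1 / 2 < α) (hm : 0 < m) (net : FeedforwardNetwork s n)
    (hW : net.WeightsBoundedBy w) (hφ : net.ActivationsLipschitz L)
    {x : EuclideanSpace ℝ (Fin n)} (hx : ‖x‖ = 1)
    (hA : ∀ i j, Measurable fun ω => A ω i j)
    (hAlaw : ∀ i j, μ.map (fun ω => A ω i j) = gaussianReal 0 1)
    (hη : ∀ i, Measurable fun ω => η ω i) (hηv : ∀ ω i, η ω i = 1 ∨ η ω i = -1)
    (hηα : ∀ i, μ {ω | η ω i = 1} = ENNReal.ofReal α)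
    (hind : iIndepFun (fun (k : (Fin m × Fin n) ⊕ Fin m) (ω : Ω) =>
          Sum.elim (fun ij => A ω ij.1 ij.2) (fun i => η ω i) k) μ)
    (h : 6912 * (s * (r ^ 2 + net.depth * Real.log (L * net.maxWidth * w))) ≤ ε ^ 2 * m)
    (Z : Finset (EuclideanSpace ℝ (Fin s))) (zbar : EuclideanSpace ℝ (Fin s))
    (hZ : ∀ z ∈ Z, z ∈ feasibleSet net.eval r) (hzbar : zbar ∈ feasibleSet net.eval r) :
    μ {ω | ∃ z ∈ Z, ε < √(2 * Real.pi) / m * (oneBitMeasurement (A ω) (η ω) x ⬝ᵥ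
        (A ω *ᵥ (net.eval z - net.eval zbar).ofLp)) -
        2 * (2 * α - 1) * ⟪x, net.eval z - net.eval zbar⟫_ℝ} ≤
      4 * ENNReal.ofReal (Real.exp (-(ε ^ 2 * m / 2304))) := by
  have hm' : (0 : ℝ) < m := by exact_mod_cast hm
  have (i : Fin m) : IsProbabilityMeasure (μ.map fun ω => η ω i) :=
    Measure.isProbabilityMeasure_map (hη i).aemeasurable
  set X : Ω → Fin m → ℝ × EuclideanSpace ℝ (Fin n) := fun ω i => (η ω i, WithLp.toLp 2 (A ω i))
  have hX : Measurable X := by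
    refine measurable_pi_iff.2 fun i => (hη i).prodMk ?_
    exact (WithLp.measurable_toLp 2 _).comp (measurable_pi_iff.2 fun j => hA i j)
  have hlaw := map_rows_eq_pi hA hAlaw hη hind
  set v : EuclideanSpace ℝ (Fin s) → EuclideanSpace ℝ (Fin n) := fun z => net.eval z - net.eval zbar
  set β := 2 * α - 1
  have hmeas (ω : Ω) (z) : oneBitMeasurement (A ω) (η ω) x ⬝ᵥ (A ω *ᵥ (v z).ofLp) =
      ∑ i, (X ω i).1 * signPM ⟪x, (X ω i).2⟫_ℝ * ⟪(X ω i).2, v z⟫_ℝ := by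
    simp only [dotProduct, oneBitMeasurement, mulVec_apply_eq_inner, X, real_inner_comm x]
  have hev := measure_exists_lt_measurement_eq hx hX hlaw hηv Z v
    (fun z => 2 * β * ⟪x, v z⟫_ℝ) (√(2 * Real.pi) / m) ε
  change μ {ω | ∃ z ∈ Z, ε < √(2 * Real.pi) / m * (oneBitMeasurement (A ω) (η ω) x ⬝ᵥ
    (A ω *ᵥ (v z).ofLp)) - 2 * β * ⟪x, v z⟫_ℝ} ≤ _
  simp only [hmeas]
  rw [hev]
  set U : Ω → ℝ := fun ω => ∑ i, ((X ω i).1 * |⟪x, (X ω i).2⟫_ℝ| - ⟪x, (X ω i).2⟫_ℝ -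
    β * √(2 / Real.pi))
  have hscalar := measure_abs_sum_flip_ge_le (τ := ε * m / 12) hx hX hlaw hηv
    (fun i => integral_sign_flip hα (hη i) (fun ω => hηv ω i) (hηα i)) (by positivity)
  set a : ℝ := ε * √m / 6
  have ha2 : a ^ 2 = ε ^ 2 * m / 36 := by
    simp only [a]
    rw [div_pow, mul_pow, Real.sq_sqrt hm'.le]
    norm_num
  have hgauss := net.gaussianPi_exists_lt_eval_le (a := a) hL hw (by positivity) hW hφ
    (by rw [ha2]; linarith) Z zbar hZ hzbar
  have hcol := map_normalized_column_sums hm hA hAlaw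
    (hind.precomp (g := Sum.inl) Sum.inl_injective)
  have hopen : MeasurableSet {g : Fin n → ℝ | ∃ z ∈ Z, a <
      ∑ i, g i * (net.eval z i - net.eval zbar i)} := by
    have : {g : Fin n → ℝ | ∃ z ∈ Z, a < ∑ i, g i * (net.eval z i - net.eval zbar i)} =
        ⋃ z ∈ Z, {g | a < ∑ i, g i * (net.eval z i - net.eval zbar i)} := by
      ext g
      simp
    rw [this]
    exact Finset.measurableSet_biUnion _ fun z _ => measurableSet_lt measurable_const (by fun_prop)
  rw [← hcol.measure_preimage hopen.nullMeasurableSet] at hgauss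
  have hπ : √(2 * Real.pi) * √(2 / Real.pi) = 2 := by
    rw [← Real.sqrt_mul (by positivity)]
    have : 2 * Real.pi * (2 / Real.pi) = 2 ^ 2 := by
      field_simp
    rw [this]
    exact Real.sqrt_sq (by norm_num)
  have hsub : {ω | ∃ z ∈ Z, ε < √(2 * Real.pi) / m * (∑ i, ⟪(X ω i).2, v z⟫_ℝ +
        (∑ i, ((X ω i).1 * |⟪x, (X ω i).2⟫_ℝ| - ⟪x, (X ω i).2⟫_ℝ)) * ⟪x, v z⟫_ℝ) -
        2 * β * ⟪x, v z⟫_ℝ} ⊆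
      ((fun ω j => ∑ i, A ω i j * (√m)⁻¹) ⁻¹' {g : Fin n → ℝ | ∃ z ∈ Z, a <
        ∑ i, g i * (net.eval z i - net.eval zbar i)}) ∪ {ω | ε * m / 12 ≤ |U ω|} := by
    rintro ω ⟨z, hz, hlt⟩
    by_contra hcon
    simp only [Set.mem_union, Set.mem_preimage, Set.mem_ofPred_eq, not_or, not_exists, not_and,
      not_lt, not_le] at hcon
    obtain ⟨h1, h2⟩ := hcon
    have h1 := h1 z hz
    have e1 : ∑ j, (∑ i, A ω i j * (√m)⁻¹) * (net.eval z j - net.eval zbar j) =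
        (√m)⁻¹ * ∑ i, ⟪(X ω i).2, v z⟫_ℝ := by
      simp only [X, v, PiLp.inner_apply, PiLp.sub_apply, Finset.sum_mul, Finset.mul_sum]
      rw [Finset.sum_comm]
      refine Finset.sum_congr rfl fun i _ => Finset.sum_congr rfl fun j _ => ?_
      simp
      ring
    rw [e1] at h1
    have e2 : ∑ i, ((X ω i).1 * |⟪x, (X ω i).2⟫_ℝ| - ⟪x, (X ω i).2⟫_ℝ) =
        U ω + m * (β * √(2 / Real.pi)) := by
      simp only [U, Finset.sum_sub_distrib, Finset.sum_const, Finset.card_univ, Fintype.card_fin,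
        nsmul_eq_mul]
      ring
    rw [e2] at hlt
    set T := ∑ i, ⟪(X ω i).2, v z⟫_ℝ
    have hinner : |⟪x, v z⟫_ℝ| ≤ 2 := by
      refine (abs_real_inner_le_norm _ _).trans ?_
      rw [hx, one_mul]
      exact (norm_sub_le _ _).trans (by linarith [(hZ z hz).2, hzbar.2])
    have e3 : √(2 * Real.pi) / m * (T + (U ω + m * (β * √(2 / Real.pi))) * ⟪x, v z⟫_ℝ) -
        2 * β * ⟪x, v z⟫_ℝ = √(2 * Real.pi) / m * T + √(2 * Real.pi) / m * (U ω * ⟪x, v z⟫_ℝ) := by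
      have : 2 * β = √(2 * Real.pi) / m * (m * (β * √(2 / Real.pi))) := by
        rw [div_mul_eq_mul_div, mul_left_comm, mul_div_cancel_left₀ _ hm'.ne', mul_left_comm, hπ]
        ring
      rw [this]
      ring
    rw [e3] at hlt
    have hT : √(2 * Real.pi) / m * T ≤ ε / 2 := by
      have h3 : T ≤ ε * m / 6 := by
        rw [inv_mul_le_iff₀ (by positivity)] at h1
        refine h1.trans (le_of_eq ?_)
        simp only [a]
        rw [← mul_div_assoc, mul_left_comm, Real.mul_self_sqrt hm'.le]
      calc √(2 * Real.pi) / m * T ≤ √(2 * Real.pi) / m * (ε * m / 6) := by gcongr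
        _ ≤ 3 / m * (ε * m / 6) := by
          gcongr
          exact sqrt_two_pi_le_three
        _ = ε / 2 := by
          field_simp
          norm_num
    have hU : √(2 * Real.pi) / m * (U ω * ⟪x, v z⟫_ℝ) ≤ ε / 2 := by
      have h3 : U ω * ⟪x, v z⟫_ℝ ≤ ε * m / 12 * 2 := by
        refine (le_abs_self _).trans ?_
        rw [abs_mul]
        gcongr
      calc √(2 * Real.pi) / m * (U ω * ⟪x, v z⟫_ℝ) ≤ √(2 * Real.pi) / m * (ε * m / 12 * 2) := by
            gcongr
        _ ≤ 3 / m * (ε * m / 12 * 2) := by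
          gcongr
          exact sqrt_two_pi_le_three
        _ = ε / 2 := by
          field_simp
          norm_num
    linarith
  refine (measure_mono hsub).trans ((measure_union_le _ _).trans ?_)
  have h4 : (4 : ℝ≥0∞) = 2 + 2 := by norm_num
  rw [h4, add_mul]
  refine add_le_add (hgauss.trans ?_) (hscalar.trans ?_)
  · refine mul_le_mul' le_rfl (ENNReal.ofReal_le_ofReal (Real.exp_le_exp.2 ?_))
    rw [ha2]
    linarith
  · refine mul_le_mul' le_rfl (ENNReal.ofReal_le_ofReal (Real.exp_le_exp.2 ?_))
    have : (ε * m / 12) ^ 2 / (12 * m) = ε ^ 2 * m / 1728 := by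
      field_simp
      norm_num
    rw [this]
    have : 0 ≤ ε ^ 2 * m := by positivity
    linarith

end Model

lemma isCompact_feasibleSet {s n : ℕ} {G : EuclideanSpace ℝ (Fin s) → EuclideanSpace ℝ (Fin n)}
    (hG : Continuous G) (r : ℝ) : IsCompact (feasibleSet G r) := by
  refine (isCompact_closedBall (0 : EuclideanSpace ℝ (Fin s)) r).of_isClosed_subset ?_ ?_
  · exact (isClosed_le continuous_norm continuous_const).inter
      (isClosed_le hG.norm continuous_const)
  · intro z hz
    simpa using hz.1

lemma norm_sub_sq_le_of_loss_le {m n : ℕ} {A : Matrix (Fin m) (Fin n) ℝ} {y : Fin m → ℝ}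
    {x u v : EuclideanSpace ℝ (Fin n)} {α δ ε : ℝ} (hα : 1 / 2 < α) (hα1 : α ≤ 1) (hv : ‖v‖ ≤ 1)
    (hloss : oneBitLoss A y u ≤ oneBitLoss A y v + δ)
    (hdev : √(2 * Real.pi) / m * (y ⬝ᵥ (A *ᵥ (u - v).ofLp)) - 2 * (2 * α - 1) * ⟪x, u - v⟫_ℝ ≤ ε) :
    ‖u - x‖ ^ 2 ≤ ‖v - x‖ ^ 2 + (δ + ε) / (2 * α - 1) + 2 * (1 - α) / (2 * α - 1) := by
  have hβ : 0 < 2 * α - 1 := by linarith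
  rw [WithLp.ofLp_sub, mulVec_sub, dotProduct_sub, inner_sub_right] at hdev
  simp only [oneBitLoss] at hloss
  rw [norm_sub_sq_real, norm_sub_sq_real, real_inner_comm x u, real_inner_comm x v, add_assoc,
    ← add_div, ← sub_le_iff_le_add', le_div_iff₀ hβ]
  have h1 : ‖v‖ ^ 2 ≤ 1 := by nlinarith [norm_nonneg v]
  have h2 : (1 - α) * (‖v‖ ^ 2 - ‖u‖ ^ 2) ≤ (1 - α) * 1 :=
    mul_le_mul_of_nonneg_left (by nlinarith [sq_nonneg ‖u‖]) (by linarith)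
  linarith

theorem corollary1 :
    ∃ C c : ℝ, 0 < C ∧ 0 < c ∧
      ∀ (s n m : ℕ) (net : FeedforwardNetwork s n) (L : NNReal) (w r ε α : ℝ)
        (xstar : EuclideanSpace ℝ (Fin n))
        (Ω : Type*) [MeasurableSpace Ω] (μ : Measure Ω) [IsProbabilityMeasure μ]
        (A : Ω → Matrix (Fin m) (Fin n) ℝ) (η : Ω → Fin m → ℝ),
        0 < L → 0 < w → 0 < ε → 1 / 2 < α → α ≤ 1 →
        net.WeightsBoundedBy w → net.ActivationsLipschitz L →
        ‖xstar‖ = 1 →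
        -- the entries of `A` are standard Gaussian
        (∀ i j, Measurable fun ω => A ω i j) →
        (∀ i j, μ.map (fun ω => A ω i j) = gaussianReal 0 1) →
        -- the entries of `η` are `1` with probability `α` and `-1` otherwise
        (∀ i, Measurable fun ω => η ω i) →
        (∀ ω i, η ω i = 1 ∨ η ω i = -1) →
        (∀ i, μ {ω | η ω i = 1} = ENNReal.ofReal α) →
        -- all entries of `A` and of `η` are jointly independent
        iIndepFun (fun (k : (Fin m × Fin n) ⊕ Fin m) (ω : Ω) =>
          Sum.elim (fun ij => A ω ij.1 ij.2) (fun i => η ω i) k) μ →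
        (m : ℝ) ≥ C * (ε ^ 2)⁻¹ * s *
          (r ^ 2 + net.depth * Real.log (L * net.maxWidth * w)) →
        ∃ E : Set Ω, MeasurableSet E ∧
          μ.real E ≥ 1 - 4 * Real.exp (-c * ε ^ 2 * m) ∧
          ∀ ω ∈ E, ∀ (δ : ℝ) (ztilde : EuclideanSpace ℝ (Fin s)),
            IsApproxMinOn
              (fun z => oneBitLoss (A ω) (oneBitMeasurement (A ω) (η ω) xstar) (net.eval z))
              (feasibleSet net.eval r) δ ztilde →
            ∃ zbar ∈ feasibleSet net.eval r,
              IsMinOn (fun z => ‖net.eval z - xstar‖ ^ 2) (feasibleSet net.eval r) zbar ∧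
              ‖net.eval ztilde - xstar‖ ^ 2 ≤ ‖net.eval zbar - xstar‖ ^ 2
                + (δ + ε) / (2 * α - 1) + 2 * (1 - α) / (2 * α - 1) := by
  refine ⟨6912, 1 / 2304, by norm_num, by norm_num, ?_⟩
  intro s n m net L w r ε α xstar Ω _ μ _ A η hL hw hε hα hα1 hW hφ hx hA hAlaw hη hηv hηα hind hm
  rcases Nat.eq_zero_or_pos m with rfl | hmpos
  · refine ⟨∅, MeasurableSet.empty, ?_, by simp⟩
    simp
  have hcont := net.continuous_eval hφ
  rcases (feasibleSet net.eval r).eq_empty_or_nonempty with hF | hF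
  · refine ⟨Set.univ, MeasurableSet.univ, ?_, ?_⟩
    · rw [probReal_univ]
      linarith [Real.exp_pos (-(1 / 2304) * ε ^ 2 * m)]
    · rintro ω - δ z hz
      exact absurd (hF ▸ hz.1) (Set.notMem_empty z)
  obtain ⟨zbar, hzbar, hmin⟩ := (isCompact_feasibleSet hcont r).exists_isMinOn hF
    (f := fun z => ‖net.eval z - xstar‖ ^ 2) (by fun_prop)
  set D : EuclideanSpace ℝ (Fin s) → Ω → ℝ := fun z ω =>
    √(2 * Real.pi) / m * (oneBitMeasurement (A ω) (η ω) xstar ⬝ᵥ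
        (A ω *ᵥ (net.eval z - net.eval zbar).ofLp)) -
        2 * (2 * α - 1) * ⟪xstar, net.eval z - net.eval zbar⟫_ℝ
  have hm' : 6912 * (s * (r ^ 2 + net.depth * Real.log (L * net.maxWidth * w))) ≤ ε ^ 2 * m := by
    have := mul_le_mul_of_nonneg_left hm (sq_nonneg ε)
    refine le_trans (le_of_eq ?_) this
    field_simp
  have hbad : μ {ω | ∃ z ∈ feasibleSet net.eval r, ε < D z ω} ≤
      4 * ENNReal.ofReal (Real.exp (-(ε ^ 2 * m / 2304))) := by
    refine measure_exists_mem_lt_le (fun ω => ?_) fun Z hZ =>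
      measure_exists_deviation_le hL hw hε hα hmpos net hW hφ hx hA hAlaw hη hηv hηα hind hm' Z
        zbar hZ hzbar
    simp only [D, dotProduct, mulVec]
    fun_prop
  set B := toMeasurable μ {ω | ∃ z ∈ feasibleSet net.eval r, ε < D z ω}
  refine ⟨Bᶜ, (measurableSet_toMeasurable _ _).compl, ?_, ?_⟩
  · rw [probReal_compl_eq_one_sub (measurableSet_toMeasurable _ _)]
    have h1 : μ.real B ≤ 4 * Real.exp (-(ε ^ 2 * m / 2304)) := by
      rw [measureReal_def, measure_toMeasurable]
      refine ENNReal.toReal_le_of_le_ofReal (by positivity) (hbad.trans (le_of_eq ?_))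
      rw [ENNReal.ofReal_mul (by norm_num), ENNReal.ofReal_ofNat]
    have h2 : -(1 / 2304) * ε ^ 2 * m = -(ε ^ 2 * m / 2304) := by ring
    rw [h2]
    linarith
  · intro ω hω δ z hz
    refine ⟨zbar, hzbar, hmin, norm_sub_sq_le_of_loss_le hα hα1 hzbar.2 (hz.2 zbar hzbar) ?_⟩
    by_contra! hcon
    exact hω (subset_toMeasurable _ _ ⟨z, hz.1, hcon⟩)
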